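/- The following is provable in $\mathsf{RCA}_0$ (equivalently: it holds in every model of $\mathsf{RCA}_0$, where all numbers, finite sets, sequences and sets below are those of the model). **Definitions.** Let $\mathcal P_{\mathrm{fin}}(\mathbb N)$ be the set of (codes of) finite subsets of $\mathbb N$. Fix generators $G=\{g_i\}_{i\in\mathbb N}$ and identify $g_i$ with $i$. An *expression* $a=\bigvee_k\bigwedge_{g\in p_k}g$ is a sequence $\langle p_k\rangle_{k\in\mathbb N}$ in which each $p_k$ is a finite set of generators or the formal bottom $\bot$ (the joinands of $a$ are the $p_k\ne\bot$; so the empty join is an expression); a finite set $p$ is also regarded as the constant expression $\langle p,p,\dots\rangle$. Put $a\le b$ iff every joinand of $a$ includes some joinand of $b$ as a subset. Joins of sequences of expressions, and binary meets, are formed in the usual way, by the infinite distributive law. A *countably presented frame* $\langle G;R\rangle$ is given by a sequence $R=\{(u_j,v_j)\}_{j\in\mathbb N}$ of pairs of expressions. - *The preorder $\prec$.* Let $Q=\{w_i:i\in\mathbb N\}$ be a sequence of expressions that includes all finite sets of generators and all $u_j,v_j$, and let $\prec_Q$ be a set that is a reflexive relation on $Q$ (given on indices) with $R\subseteq{\prec_Q}$.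 Let $\varphi(Q,(p_i))$ say that $p_i\subseteq p_{i+1}$ for all $i$, and that whenever $p_i\le c\prec_Q d$ there is $k$ with $p_k\le d$. Write $a\prec_m b$ (the congruence preorder generated by $(Q,\prec_Q)$) if for every sequence $(p_i)$ of finite sets with $\varphi(Q,(p_i))$ and $p_0\le a$ there are $i$ and $r,l\in Q$ with $p_i\le r\prec_Q l\le b$. Then $a\prec b$ iff $a\prec_m b$ for every such $(Q,\prec_Q)$. - *The preorder $\subseteq_{\mathrm{pt}}$.* A *point* of $\langle G;R\rangle$ is a sequence $(p_i)$ of finite sets with $p_i\subseteq p_{i+1}$ such that the relation "$\exists k\,(p_k\le a)\rightarrow\exists h\,(p_h\le b)$" on expressions is a congruence preorder, that is, it includes $\le$ and $R$ and is transitive. Then $a\subseteq_{\mathrm{pt}}b$ iff for every point $(p_i)$, $\exists k\,(p_k\le a)$ implies $\exists h\,(p_h\le b)$. - *$\mathbf\Pi^0_2$ subspaces.* A point of $\mathcal P(\mathbb N)$ is a sequence $x=\langle q_i\rangle$ of finite sets with $q_i\subseteq\{0,\dots,i\}$ and $q_i\subseteq q_j$ for $i<j$; $x\in N_w$ iff $w\subseteq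 q_i$ for some $i$. An open set is coded by a set $U\subseteq\mathbb N\times\mathcal P_{\mathrm{fin}}(\mathbb N)$, and $x\in U$ iff $x\in N_w$ for some $(n,w)\in U$. A $\mathbf\Pi^0_2$ subspace $X=\bigcap_i\big(V_i\cup(\mathcal P(\mathbb N)\setminus U_i)\big)$ is coded by two double sequences listing basic open sets (or $\emptyset$) whose unions are the $V_i$ and the $U_i$. Two increasing sequences of finite sets are *equal as filters* if each entry of either one is included in some entry of the other. - For an expression $a$ let $f(a)$ be the open set coded by $\{(k,p_k):p_k\neq\bot\}$. A frame with a preorder $\triangleleft$ is *spatial with space $X$* if $f$ is an isomorphism of frames from the expressions preordered by $\triangleleft$ onto the open sets of $X$: $a\triangleleft b\Leftrightarrow\forall x\in X\,(x\in f(a)\rightarrow x\in f(b))$ for all expressions $a,b$; every open set agrees on $X$ with some $f(a)$; countable joins and finite meets of expressions exist, and $f$ takes them to unions and intersections on $X$. **Statement.** The following representations are equivalent: (1) countably presented frames with $\prec$; (2) countably presented frames with $\subseteq_{\mathrm{pt}}$; (3) $\mathbf\Pi^0_2$ subspaces of $\mathcal P(\mathbb N)$. That is: (a) For every countably presented frame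 $\langle G;R\rangle$, both $\langle G;R\rangle$ with $\prec$ and $\langle G;R\rangle$ with $\subseteq_{\mathrm{pt}}$ are spatial with space $$X_R=\bigcap_{j\in\mathbb N}\big(f(v_j)\cup(\mathcal P(\mathbb N)\setminus f(u_j))\big),$$ and $X_R$ is the space of points of the frame: every point of $X_R$ is a point of the frame, every point of the frame is equal as a filter to a point of $X_R$, and if a point $(p_i)$ of the frame is equal as a filter to $x\in X_R$, then $\exists k\,(p_k\le a)\Leftrightarrow x\in f(a)$ for every expression $a$. (b) For every countably presented frame and all expressions $a,b$: $a\prec b\Leftrightarrow a\subseteq_{\mathrm{pt}}b$. (c) For every $\mathbf\Pi^0_2$ subspace $X=\bigcap_i\big(V_i\cup(\mathcal P(\mathbb N)\setminus U_i)\big)$ of $\mathcal P(\mathbb N)$, the frame $\langle\mathbb N;\{(U_i,V_i)\}_i\rangle$ with $\prec$, and likewise with $\subseteq_{\mathrm{pt}}$, is spatial with space $X$, and $X$ is its space of points in the sense of (a). (d) The translations $R\mapsto X_R$ in (a) and $X\mapsto\langle\mathbb N;\{(U_i,V_i)\}_i\rangle$ in (c) are mutually inverse on codes. -/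

import Mathlib

/-!
A structure for the language of second-order arithmetic is a type `M` of numbers with
`0, 1, +, *, <`, together with a collection `S : Set (Set M)` of sets. Such a structure need not
be standard. A statement is provable in `RCA₀` iff it holds in all models of `RCA₀`, so the
theorem is stated about an arbitrary model. Every quantifier below ranges over the numbers in `M`,
over the sets in `S`, or over functions whose graph is in `S`.
-/

namespace SecondOrderArith

universe u

/-! ### The axioms of `RCA₀` -/

/-- Number terms with free variables among `x₀, …, xₙ₋₁`. -/
inductive ArithTerm : ℕ → Type
  | var {n : ℕ} (i : Fin n) : ArithTerm n
  | zero {n : ℕ} : ArithTerm n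
  | one {n : ℕ} : ArithTerm n
  | add {n : ℕ} (s t : ArithTerm n) : ArithTerm n
  | mul {n : ℕ} (s t : ArithTerm n) : ArithTerm n

/-- Bounded-quantifier (`Σ⁰₀`) formulas with free number variables among `x₀, …, xₙ₋₁` and set
variables `X₀, X₁, …`. In `ball t φ` (for all `x < t`) the bound variable is variable `0` of `φ`. -/
inductive BddFormula : ℕ → Type
  | eq {n : ℕ} (s t : ArithTerm n) : BddFormula n
  | lt {n : ℕ} (s t : ArithTerm n) : BddFormula n
  | mem {n : ℕ} (t : ArithTerm n) (X : ℕ) : BddFormula n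
  | not {n : ℕ} (φ : BddFormula n) : BddFormula n
  | and {n : ℕ} (φ ψ : BddFormula n) : BddFormula n
  | ball {n : ℕ} (t : ArithTerm n) (φ : BddFormula (n + 1)) : BddFormula n

section Structure

variable {M : Type u} [Zero M] [One M] [Add M] [Mul M] [LT M]

/-- The value of a term. -/
def ArithTerm.eval : {n : ℕ} → ArithTerm n → (Fin n → M) → M
  | _, .var i, v => v i
  | _, .zero, _ => 0
  | _, .one, _ => 1
  | _, .add s t, v => s.eval v + t.eval v
  | _, .mul s t, v => s.eval v * t.eval v

/-- Truth of a bounded formula under an assignment `W` of the set variables and an assignment `v`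
of the number variables. -/
def BddFormula.Holds (W : ℕ → Set M) : {n : ℕ} → BddFormula n → (Fin n → M) → Prop
  | _, .eq s t, v => s.eval v = t.eval v
  | _, .lt s t, v => s.eval v < t.eval v
  | _, .mem t X, v => t.eval v ∈ W X
  | _, .not φ, v => ¬ φ.Holds W v
  | _, .and φ ψ, v => φ.Holds W v ∧ ψ.Holds W v
  | _, .ball t φ, v => ∀ x : M, x < t.eval v → φ.Holds W (Fin.cons x v)

/-- `(M, S)` is a model of `RCA₀`: the basic axioms, induction for `Σ⁰₁` formulas, and comprehension
for `Δ⁰₁` formulas, with number and set parameters from the model. -/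
structure ModelsRCA0 (S : Set (Set M)) : Prop where
  sets_nonempty : S.Nonempty
  succ_ne_zero : ∀ m : M, m + 1 ≠ 0
  succ_inj : ∀ m n : M, m + 1 = n + 1 → m = n
  add_zero : ∀ m : M, m + 0 = m
  add_succ : ∀ m n : M, m + (n + 1) = (m + n) + 1
  mul_zero : ∀ m : M, m * 0 = 0
  mul_succ : ∀ m n : M, m * (n + 1) = m * n + m
  not_lt_zero : ∀ m : M, ¬ m < 0
  lt_succ : ∀ m n : M, m < n + 1 ↔ m < n ∨ m = n
  sigma_induction : ∀ {n : ℕ} (θ : BddFormula (n + 2)) (W : ℕ → Set M) (v : Fin n → M),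
    (∀ i, W i ∈ S) →
    (∃ y, θ.Holds W (Fin.cons y (Fin.cons 0 v))) →
    (∀ x, (∃ y, θ.Holds W (Fin.cons y (Fin.cons x v))) →
      ∃ y, θ.Holds W (Fin.cons y (Fin.cons (x + 1) v))) →
    ∀ x, ∃ y, θ.Holds W (Fin.cons y (Fin.cons x v))
  delta_comprehension : ∀ {n : ℕ} (θ η : BddFormula (n + 2)) (W : ℕ → Set M) (v : Fin n → M),
    (∀ i, W i ∈ S) →
    (∀ x, (∃ y, θ.Holds W (Fin.cons y (Fin.cons x v))) ↔
      ∀ y, η.Holds W (Fin.cons y (Fin.cons x v))) →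
    {x | ∃ y, θ.Holds W (Fin.cons y (Fin.cons x v))} ∈ S

/-! ### Coding of pairs, finite sets and sequences -/

/-- The pair `(i, j)`, coded as `(i + j)² + i`. -/
def pair (i j : M) : M := (i + j) * (i + j) + i

/-- `i` is an element of the finite set coded by the number `c`: if `c = ((k, m), n)`, the set is
`{i < k : m (i + 1) + 1 divides n}`; a number that is not of this form codes the empty set. In a
model of `RCA₀` the sets coded in this way are exactly the bounded sets in `S`. -/
def FinMem (i c : M) : Prop :=
  ∃ k m n d : M, c = pair (pair k m) n ∧ i < k ∧ n = (m * (i + 1) + 1) * d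

/-- Inclusion of coded finite sets. -/
def FinSub (p q : M) : Prop := ∀ i : M, FinMem i p → FinMem i q

/-- `f` is a sequence of numbers of the model. -/
def IsSeq (S : Set (Set M)) (f : M → M) : Prop :=
  {z | ∃ x, z = pair x (f x)} ∈ S

/-- `w` is a double sequence of numbers of the model. -/
def IsDoubleSeq (S : Set (Set M)) (w : M → M → M) : Prop :=
  {z | ∃ x y, z = pair (pair x y) (w x y)} ∈ S

/-! ### Expressions and countably presented frames

The generators are `gᵢ` for `i : M`, and `gᵢ` is identified with its index `i`. An expression
`⋁ₖ ⋀ fₖ` is a sequence `a` whose entries are finite sets of generators or the formal bottom: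
`a k = p + 1` says that `fₖ` is the finite set coded by `p`, and `a k = 0` says that the
`k`-th joinand is the formal bottom (so that the empty join is an expression). -/

/-- The finite set coded by `p` is one of the joinands of `a`. -/
def Joinand (a : M → M) (p : M) : Prop := ∃ k, a k = p + 1

/-- The finite set coded by `p`, as an expression. -/
def basic (p : M) : M → M := fun _ => p + 1

/-- The preorder `a ≤ b` on expressions. -/
def ExprLe (a b : M → M) : Prop :=
  ∀ p, Joinand a p → ∃ q, Joinand b q ∧ FinSub q p

/-- `c` is the join of the expressions `w 0, w 1, …`. -/
def IsJoinExpr (c : M → M) (w : M → M → M) : Prop :=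
  ∀ p, Joinand c p ↔ ∃ n, Joinand (w n) p

/-- `r` codes the union of the finite sets coded by `p` and `q`. -/
def IsFinUnion (r p q : M) : Prop := ∀ i, FinMem i r ↔ FinMem i p ∨ FinMem i q

/-- `c` is the meet of the expressions `a` and `b`, computed by the distributive law. -/
def IsMeetExpr (c a b : M → M) : Prop :=
  (∀ r, Joinand c r → ∃ p q, Joinand a p ∧ Joinand b q ∧ IsFinUnion r p q) ∧
  (∀ p q, Joinand a p → Joinand b q → ∃ r, Joinand c r ∧ IsFinUnion r p q)

/-- A countably presented frame: the sequence of relations `(lhs j, rhs j)`, `j : M`. -/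
structure FrameCode (S : Set (Set M)) where
  lhs : M → M → M
  rhs : M → M → M
  lhs_mem : IsDoubleSeq S lhs
  rhs_mem : IsDoubleSeq S rhs

/-- A set `(Q, ≺_Q)` that generates a congruence preorder: `Q = {expr i : i : M}` contains all finite
sets of generators and all expressions in the relations, and `≺_Q` (a set of pairs of indices)
is a reflexive relation on `Q` that contains the relations of the frame. -/
structure CongruenceCode {S : Set (Set M)} (F : FrameCode S) where
  expr : M → M → M
  expr_mem : IsDoubleSeq S expr
  rel : Set M
  rel_mem : rel ∈ S
  finite_mem : ∀ p, ∃ i, expr i = basic p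
  relation_mem : ∀ j, ∃ c d, expr c = F.lhs j ∧ expr d = F.rhs j ∧ pair c d ∈ rel
  refl_mem : ∀ i, pair i i ∈ rel

/-- The condition `φ(Q, (pᵢ))`. -/
def CongruenceCode.Phi {S : Set (Set M)} {F : FrameCode S} (Q : CongruenceCode F)
    (p : M → M) : Prop :=
  (∀ i, FinSub (p i) (p (i + 1))) ∧
  ∀ c d i, pair c d ∈ Q.rel → ExprLe (basic (p i)) (Q.expr c) →
    ∃ k, ExprLe (basic (p k)) (Q.expr d)

/-- The congruence preorder `a ≺_m b` generated by `(Q, ≺_Q)`. -/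
def CongruenceCode.Prec {S : Set (Set M)} {F : FrameCode S} (Q : CongruenceCode F)
    (a b : M → M) : Prop :=
  ∀ p, IsSeq S p → Q.Phi p → ExprLe (basic (p 0)) a →
    ∃ i r l, ExprLe (basic (p i)) (Q.expr r) ∧ pair r l ∈ Q.rel ∧ ExprLe (Q.expr l) b

/-- The least congruence preorder: `a ≺ b` iff `a ≺_m b` for all congruence preorders `≺_m`. -/
def FrameCode.Prec {S : Set (Set M)} (F : FrameCode S) (a b : M → M) : Prop :=
  ∀ Q : CongruenceCode F, Q.Prec a b

/-- The relation `T` on expressions is a congruence preorder of the frame. -/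
def FrameCode.IsCongruencePreorder {S : Set (Set M)} (F : FrameCode S)
    (T : (M → M) → (M → M) → Prop) : Prop :=
  (∀ a b, IsSeq S a → IsSeq S b → ExprLe a b → T a b) ∧
  (∀ j, T (F.lhs j) (F.rhs j)) ∧
  (∀ a b c, IsSeq S a → IsSeq S b → IsSeq S c → T a b → T b c → T a c)

/-- The filter generated by the sequence `p` belongs to the expression `a`. -/
def SatExpr (p : M → M) (a : M → M) : Prop := ∃ k, ExprLe (basic (p k)) a

/-- A point of the frame: a decreasing sequence of finite meets of generators for which the relation
`(∃ k, p k ≤ a) → (∃ h, p h ≤ b)` is a congruence preorder. -/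
def FrameCode.IsPoint {S : Set (Set M)} (F : FrameCode S) (p : M → M) : Prop :=
  IsSeq S p ∧ (∀ i, FinSub (p i) (p (i + 1))) ∧
  F.IsCongruencePreorder (fun a b => SatExpr p a → SatExpr p b)

/-- The pointwise preorder `a ⊆_pt b`. -/
def FrameCode.PtLe {S : Set (Set M)} (F : FrameCode S) (a b : M → M) : Prop :=
  ∀ p, F.IsPoint p → SatExpr p a → SatExpr p b

/-! ### The space `P(ℕ)` and its `Π⁰₂` subspaces -/

/-- A point of `P(ℕ)`: an increasing sequence of finite sets `x i ⊆ {0, …, i}`. -/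
def IsSpacePoint (S : Set (Set M)) (x : M → M) : Prop :=
  IsSeq S x ∧ (∀ i n, FinMem n (x i) → n < i + 1) ∧ (∀ i j, i < j → FinSub (x i) (x j))

/-- `x` belongs to the basic open set `N_w`. -/
def MemBasic (x : M → M) (w : M) : Prop := ∃ k, FinSub w (x k)

/-- `x` belongs to the open set coded by `U`, a set of pairs `(n, w)`. -/
def MemOpen (x : M → M) (U : Set M) : Prop := ∃ n w, pair n w ∈ U ∧ MemBasic x w

/-- Two sequences are equal as filters. -/
def SamePoint (p q : M → M) : Prop :=
  (∀ i, ∃ j, FinSub (p i) (q j)) ∧ (∀ j, ∃ i, FinSub (q j) (p i))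

/-- A code for a `Π⁰₂` subspace `⋂ᵢ (Aᵢ ∪ Bᵢ)` of `P(ℕ)`, with `Bᵢ` the union of the basic open sets
listed by `op i` and `Aᵢ` the complement of the union of those listed by `cl i`. An entry `w + 1`
is the basic open set `N_w` and an entry `0` is the empty set. -/
structure Pi2Code (S : Set (Set M)) where
  op : M → M → M
  cl : M → M → M
  op_mem : IsDoubleSeq S op
  cl_mem : IsDoubleSeq S cl

/-- `x` is a point of the `Π⁰₂` subspace. -/
def Pi2Code.Mem {S : Set (Set M)} (X : Pi2Code S) (x : M → M) : Prop :=
  IsSpacePoint S x ∧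
  ∀ i, (¬ ∃ n w, X.cl i n = w + 1 ∧ MemBasic x w) ∨ (∃ n w, X.op i n = w + 1 ∧ MemBasic x w)

/-! ### Spatiality and the translations -/

/-- The code of the open set `f(a)` of an expression `a`. -/
def openOf (a : M → M) : Set M := {z | ∃ k p, z = pair k p ∧ a k = p + 1}

/-- The map `a ↦ f(a)` is an isomorphism from the frame of expressions, preordered by `T`, onto the
frame of open sets of `X`. -/
structure IsSpatial {S : Set (Set M)} (T : (M → M) → (M → M) → Prop) (X : Pi2Code S) : Prop where
  open_mem : ∀ a, IsSeq S a → openOf a ∈ S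
  reflects : ∀ a b, IsSeq S a → IsSeq S b →
    (T a b ↔ ∀ x, X.Mem x → MemOpen x (openOf a) → MemOpen x (openOf b))
  surjective : ∀ U ∈ S, ∃ a, IsSeq S a ∧ ∀ x, X.Mem x → (MemOpen x (openOf a) ↔ MemOpen x U)
  exists_join : ∀ w, IsDoubleSeq S w → ∃ c, IsSeq S c ∧ IsJoinExpr c w
  map_join : ∀ c w, IsSeq S c → IsDoubleSeq S w → IsJoinExpr c w →
    ∀ x, X.Mem x → (MemOpen x (openOf c) ↔ ∃ n, MemOpen x (openOf (w n)))
  exists_meet : ∀ a b, IsSeq S a → IsSeq S b → ∃ c, IsSeq S c ∧ IsMeetExpr c a b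
  map_meet : ∀ a b c, IsSeq S a → IsSeq S b → IsSeq S c → IsMeetExpr c a b →
    ∀ x, X.Mem x → (MemOpen x (openOf c) ↔ MemOpen x (openOf a) ∧ MemOpen x (openOf b))
  map_bot : IsSeq S (fun _ => 0) ∧ ∀ x, X.Mem x → ¬ MemOpen x (openOf fun _ => 0)
  map_top : IsSeq S (basic 0) ∧ ∀ x, X.Mem x → MemOpen x (openOf (basic 0))

/-- The space of points of the frame is `X`: up to equality of filters they have the same points, and
a point of the frame belongs to an expression `a` iff it belongs to the open set `f(a)`. -/
structure IsPointSpace {S : Set (Set M)} (F : FrameCode S) (X : Pi2Code S) : Prop where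
  isPoint : ∀ x, X.Mem x → F.IsPoint x
  exists_mem : ∀ p, F.IsPoint p → ∃ x, X.Mem x ∧ SamePoint p x
  sat_iff : ∀ p x a, F.IsPoint p → X.Mem x → SamePoint p x → IsSeq S a →
    (SatExpr p a ↔ MemOpen x (openOf a))

/-- The subspace `⋂ⱼ (f(vⱼ) ∪ (P(ℕ) ∖ f(uⱼ)))` for the relations `(uⱼ, vⱼ)` of the frame. -/
def FrameCode.toPi2 {S : Set (Set M)} (F : FrameCode S) : Pi2Code S :=
  ⟨F.rhs, F.lhs, F.rhs_mem, F.lhs_mem⟩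

/-- The frame with relations `(uᵢ, vᵢ)` for the subspace `⋂ᵢ (Vᵢ ∪ (P(ℕ) ∖ Uᵢ))`. -/
def Pi2Code.toFrame {S : Set (Set M)} (X : Pi2Code S) : FrameCode S :=
  ⟨X.cl, X.op, X.cl_mem, X.op_mem⟩

end Structure

end SecondOrderArith

open SecondOrderArith

/-!
Both preorders are compared with the same third relation between `a` and `b`: every `x` in the space
that meets `a` meets `b`.

A sequence `p` meets an expression `a` if some `p k` includes a joinand of `a`; this is the relation
`SatExpr p a`, and for a point `x` of `P(ℕ)` it is membership in the open set `f(a)`. Meeting is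
preserved by `≤` for every increasing sequence, so a point of the frame is just an increasing
sequence that meets `v_j` whenever it meets `u_j` (`FrameCode.isPoint_iff`). Such a sequence can be
cut down, entry by entry, to a point of `P(ℕ)` that is equal to it as a filter
(`ModelsRCA0.exists_isSpacePoint`); hence the points of the frame are those of the space, and
`⊆_pt` is the relation above (`ModelsRCA0.ptLe_iff`).

For `≺` (`ModelsRCA0.prec_iff`): a sequence satisfying `φ(Q, p)` is a point of the frame, and if it
meets `b` it meets a joinand of `b`, which is an element of `Q`; this gives `≺` from the pointwise
relation. Conversely, the least choice of `(Q, ≺_Q)` consists of the finite sets and the relations,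
with no instances of `≺_Q` but reflexivity and the relations. For it every tail of a point of the
space satisfies `φ`, so `a ≺ b` makes each point that meets `a` meet `b`.

All of this takes place in an arbitrary model, so the sequences used have to be shown to be in the
model. Three facts do this. The numbers form an ordered commutative semiring. A total `Σ⁰₁` relation
contains the graph of a function of the model (`ModelsRCA0.exists_seq`), where definability is
handled through the closure properties of the predicates `Def0` and `Sig`. Every bounded set of the
model has a code (`ModelsRCA0.exists_code`), by the pairwise coprimality of the moduli
`m (i + 1) + 1` for a common multiple `m` of `1, …, k`.
-/

namespace SecondOrderArith

universe u

/-! ### Definability by bounded formulas -/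

section Definability

set_option linter.unusedSectionVars false

variable {M : Type u} [Zero M] [One M] [Add M] [Mul M] [LT M] {S : Set (Set M)}

/-- Simultaneous substitution of terms for the variables of a term. -/
def ArithTerm.subst : {n m : ℕ} → ArithTerm n → (Fin n → ArithTerm m) → ArithTerm m
  | _, _, .var i, σ => σ i
  | _, _, .zero, _ => .zero
  | _, _, .one, _ => .one
  | _, _, .add s t, σ => .add (s.subst σ) (t.subst σ)
  | _, _, .mul s t, σ => .mul (s.subst σ) (t.subst σ)

theorem ArithTerm.eval_subst {n m : ℕ} (t : ArithTerm n) (σ : Fin n → ArithTerm m)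
    (v : Fin m → M) : (t.subst σ).eval v = t.eval fun i => (σ i).eval v := by
  induction t with
  | var i => simp only [subst, eval]
  | zero => simp only [subst, eval]
  | one => simp only [subst, eval]
  | add s t hs ht => simp only [subst, eval, hs, ht]
  | mul s t hs ht => simp only [subst, eval, hs, ht]

/-- Renaming of the set variables along `f` and simultaneous substitution of terms for the number
variables of a bounded formula. -/
def BddFormula.subst (f : ℕ → ℕ) :
    {n m : ℕ} → BddFormula n → (Fin n → ArithTerm m) → BddFormula m
  | _, _, .eq s t, σ => .eq (s.subst σ) (t.subst σ)
  | _, _, .lt s t, σ => .lt (s.subst σ) (t.subst σ)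
  | _, _, .mem t X, σ => .mem (t.subst σ) (f X)
  | _, _, .not φ, σ => .not (φ.subst f σ)
  | _, _, .and φ ψ, σ => .and (φ.subst f σ) (ψ.subst f σ)
  | _, _, .ball t φ, σ => .ball (t.subst σ)
      (φ.subst f (Fin.cons (.var 0) fun i => (σ i).subst fun j => .var j.succ))

theorem BddFormula.holds_subst (f : ℕ → ℕ) (W : ℕ → Set M) {n m : ℕ} (φ : BddFormula n)
    (σ : Fin n → ArithTerm m) (v : Fin m → M) :
    (φ.subst f σ).Holds W v ↔ φ.Holds (W ∘ f) fun i => (σ i).eval v := by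
  induction φ generalizing m with
  | eq s t => simp only [subst, Holds, ArithTerm.eval_subst]
  | lt s t => simp only [subst, Holds, ArithTerm.eval_subst]
  | mem t X => simp only [subst, Holds, ArithTerm.eval_subst, Function.comp]
  | not φ h => simp only [subst, Holds, h]
  | and φ ψ h h' => simp only [subst, Holds, h, h']
  | ball t φ h =>
    simp only [subst, Holds, h, ArithTerm.eval_subst]
    refine forall_congr' fun x => imp_congr_right fun _ => ?_
    congr! 1
    funext i
    refine Fin.cases ?_ (fun i => ?_) i
    · simp [ArithTerm.eval]
    · simp [ArithTerm.eval, ArithTerm.eval_subst]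

/-- The function `t` of `n` numbers is the value of a term. -/
def IsTerm {n : ℕ} (t : (Fin n → M) → M) : Prop := ∃ s : ArithTerm n, ∀ v, s.eval v = t v

/-- The predicate `P` of `n` numbers is defined by a bounded formula with set parameters
from `S`. -/
def Def0 (S : Set (Set M)) {n : ℕ} (P : (Fin n → M) → Prop) : Prop :=
  ∃ (θ : BddFormula n) (W : ℕ → Set M), (∀ i, W i ∈ S) ∧ ∀ v, θ.Holds W v ↔ P v

/-- The predicate `P` of `n` numbers is `Σ⁰₁` with set parameters from `S`. -/
def Sig (S : Set (Set M)) {n : ℕ} (P : (Fin n → M) → Prop) : Prop :=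
  ∃ Q : (Fin (n + 1) → M) → Prop, Def0 S Q ∧ ∀ v, P v ↔ ∃ y, Q (Fin.cons y v)

variable {n : ℕ}

theorem IsTerm.var (i : Fin n) : IsTerm fun v : Fin n → M => v i :=
  ⟨.var i, fun _ => by simp only [ArithTerm.eval]⟩

theorem IsTerm.zero : IsTerm fun _ : Fin n → M => 0 :=
  ⟨.zero, fun _ => by simp only [ArithTerm.eval]⟩

theorem IsTerm.one : IsTerm fun _ : Fin n → M => 1 :=
  ⟨.one, fun _ => by simp only [ArithTerm.eval]⟩

theorem IsTerm.add {s t : (Fin n → M) → M} (hs : IsTerm s) (ht : IsTerm t) :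
    IsTerm fun v => s v + t v := by
  obtain ⟨s', hs⟩ := hs
  obtain ⟨t', ht⟩ := ht
  exact ⟨.add s' t', fun v => by simp only [ArithTerm.eval, hs, ht]⟩

theorem IsTerm.mul {s t : (Fin n → M) → M} (hs : IsTerm s) (ht : IsTerm t) :
    IsTerm fun v => s v * t v := by
  obtain ⟨s', hs⟩ := hs
  obtain ⟨t', ht⟩ := ht
  exact ⟨.mul s' t', fun v => by simp only [ArithTerm.eval, hs, ht]⟩

theorem IsTerm.pair {s t : (Fin n → M) → M} (hs : IsTerm s) (ht : IsTerm t) :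
    IsTerm fun v => pair (s v) (t v) :=
  ((hs.add ht).mul (hs.add ht)).add hs

theorem IsTerm.shift {t : (Fin n → M) → M} (ht : IsTerm t) :
    IsTerm fun v : Fin (n + 1) → M => t fun i => v i.succ := by
  obtain ⟨t', ht⟩ := ht
  exact ⟨t'.subst fun i => .var i.succ, fun v => by
    simp only [ArithTerm.eval_subst, ArithTerm.eval, ht]⟩

theorem Def0.eq (hS : S.Nonempty) {s t : (Fin n → M) → M} (hs : IsTerm s) (ht : IsTerm t) :
    Def0 S fun v => s v = t v := by
  obtain ⟨s', hs⟩ := hs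
  obtain ⟨t', ht⟩ := ht
  obtain ⟨U, hU⟩ := hS
  exact ⟨.eq s' t', fun _ => U, fun _ => hU, fun v => by simp only [BddFormula.Holds, hs, ht]⟩

theorem Def0.lt (hS : S.Nonempty) {s t : (Fin n → M) → M} (hs : IsTerm s) (ht : IsTerm t) :
    Def0 S fun v => s v < t v := by
  obtain ⟨s', hs⟩ := hs
  obtain ⟨t', ht⟩ := ht
  obtain ⟨U, hU⟩ := hS
  exact ⟨.lt s' t', fun _ => U, fun _ => hU, fun v => by simp only [BddFormula.Holds, hs, ht]⟩

theorem Def0.mem {U : Set M} (hU : U ∈ S) {t : (Fin n → M) → M} (ht : IsTerm t) :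
    Def0 S fun v => t v ∈ U := by
  obtain ⟨t', ht⟩ := ht
  exact ⟨.mem t' 0, fun _ => U, fun _ => hU, fun v => by simp only [BddFormula.Holds, ht]⟩

theorem Def0.not {P : (Fin n → M) → Prop} (hP : Def0 S P) : Def0 S fun v => ¬ P v := by
  obtain ⟨θ, W, hW, h⟩ := hP
  exact ⟨.not θ, W, hW, fun v => by simp only [BddFormula.Holds, h]⟩

theorem Def0.ne (hS : S.Nonempty) {s t : (Fin n → M) → M} (hs : IsTerm s) (ht : IsTerm t) :
    Def0 S fun v => s v ≠ t v :=
  (Def0.eq hS hs ht).not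

/-- Two formulas can be given the same list of set parameters, by interleaving their lists. -/
theorem Def0.common {P Q : (Fin n → M) → Prop} (hP : Def0 S P) (hQ : Def0 S Q) :
    ∃ W : ℕ → Set M, (∀ i, W i ∈ S) ∧ ∃ θ η : BddFormula n,
      (∀ v, θ.Holds W v ↔ P v) ∧ ∀ v, η.Holds W v ↔ Q v := by
  obtain ⟨θ, W, hW, h⟩ := hP
  obtain ⟨η, W', hW', h'⟩ := hQ
  have h0 : (fun i => if i % 2 = 0 then W (i / 2) else W' (i / 2)) ∘ (fun i => 2 * i) = W := by
    funext i
    simp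
  have h1 : (fun i => if i % 2 = 0 then W (i / 2) else W' (i / 2)) ∘ (fun i => 2 * i + 1) =
      W' := by
    funext i
    have e : (2 * i + 1) / 2 = i := by omega
    have e' : (2 * i + 1) % 2 = 1 := by omega
    simp [e, e']
  refine ⟨fun i => if i % 2 = 0 then W (i / 2) else W' (i / 2), fun i => ?_,
    θ.subst (fun i => 2 * i) .var, η.subst (fun i => 2 * i + 1) .var, fun v => ?_, fun v => ?_⟩
  · dsimp only
    split_ifs
    exacts [hW _, hW' _]
  · simp only [BddFormula.holds_subst, h0, ArithTerm.eval]
    exact h v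
  · simp only [BddFormula.holds_subst, h1, ArithTerm.eval]
    exact h' v

theorem Def0.and {P Q : (Fin n → M) → Prop} (hP : Def0 S P) (hQ : Def0 S Q) :
    Def0 S fun v => P v ∧ Q v := by
  obtain ⟨W, hW, θ, η, h, h'⟩ := hP.common hQ
  exact ⟨.and θ η, W, hW, fun v => by simp only [BddFormula.Holds, h, h']⟩

theorem Def0.congr {P Q : (Fin n → M) → Prop} (hP : Def0 S P) (h : ∀ v, P v ↔ Q v) : Def0 S Q := by
  obtain rfl : P = Q := funext fun v => propext (h v)
  exact hP

theorem Def0.or {P Q : (Fin n → M) → Prop} (hP : Def0 S P) (hQ : Def0 S Q) :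
    Def0 S fun v => P v ∨ Q v :=
  (hP.not.and hQ.not).not.congr fun v => by tauto

theorem Def0.imp {P Q : (Fin n → M) → Prop} (hP : Def0 S P) (hQ : Def0 S Q) :
    Def0 S fun v => P v → Q v :=
  (hP.not.or hQ).congr fun v => by tauto

theorem Def0.iff {P Q : (Fin n → M) → Prop} (hP : Def0 S P) (hQ : Def0 S Q) :
    Def0 S fun v => P v ↔ Q v :=
  ((hP.imp hQ).and (hQ.imp hP)).congr fun v => by tauto

theorem Def0.ball {t : (Fin n → M) → M} (ht : IsTerm t) {P : M → (Fin n → M) → Prop}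
    (hP : Def0 S fun v : Fin (n + 1) → M => P (v 0) fun i => v i.succ) :
    Def0 S fun v => ∀ x, x < t v → P x v := by
  obtain ⟨t', ht⟩ := ht
  obtain ⟨θ, W, hW, h⟩ := hP
  exact ⟨.ball t' θ, W, hW, fun v => by simp [BddFormula.Holds, h, ht]⟩

theorem Def0.bex {t : (Fin n → M) → M} (ht : IsTerm t) {P : M → (Fin n → M) → Prop}
    (hP : Def0 S fun v : Fin (n + 1) → M => P (v 0) fun i => v i.succ) :
    Def0 S fun v => ∃ x, x < t v ∧ P x v :=
  (Def0.ball (P := fun x v => ¬ P x v) ht hP.not).not.congr fun v => by push Not; rfl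

theorem Def0.subst {m : ℕ} {P : (Fin n → M) → Prop} (hP : Def0 S P)
    {σ : Fin n → (Fin m → M) → M} (hσ : ∀ i, IsTerm (σ i)) :
    Def0 S fun v => P fun i => σ i v := by
  obtain ⟨θ, W, hW, h⟩ := hP
  choose τ hτ using hσ
  exact ⟨θ.subst id τ, W, hW, fun v => by simp only [BddFormula.holds_subst, hτ]; exact h _⟩

theorem Def0.sig {P : (Fin n → M) → Prop} [Nonempty M] (hP : Def0 S P) : Sig S P :=
  ⟨fun w => P fun i => w i.succ, hP.subst fun i => .var i.succ, fun v => by simp⟩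

end Definability

/-! ### Arithmetic in a model -/

section Arithmetic

variable {M : Type u} [Zero M] [One M] [Add M] [Mul M] [LT M] {S : Set (Set M)} {n : ℕ}

namespace ModelsRCA0

theorem sig_induction (hS : ModelsRCA0 S) (v : Fin n → M) {Q : M → (Fin n → M) → Prop}
    (hQ : Sig S fun w : Fin (n + 1) → M => Q (w 0) fun i => w i.succ)
    (zero : Q 0 v) (succ : ∀ x, Q x v → Q (x + 1) v) (x : M) : Q x v := by
  obtain ⟨R, ⟨θ, W, hW, h⟩, hR⟩ := hQ
  have key : ∀ x, (∃ y, θ.Holds W (Fin.cons y (Fin.cons x v))) ↔ Q x v := fun x => by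
    simp only [h]
    rw [← hR]
    simp
  simp only [← key] at *
  exact hS.sigma_induction θ W v hW zero succ x

theorem def0_induction (hS : ModelsRCA0 S) (v : Fin n → M) {Q : M → (Fin n → M) → Prop}
    (hQ : Def0 S fun w : Fin (n + 1) → M => Q (w 0) fun i => w i.succ)
    (zero : Q 0 v) (succ : ∀ x, Q x v → Q (x + 1) v) (x : M) : Q x v :=
  haveI : Nonempty M := ⟨0⟩
  hS.sig_induction v hQ.sig zero succ x

/-- Induction for an equation between terms. -/
theorem eq_induction (hS : ModelsRCA0 S) (v : Fin n → M) {s t : M → (Fin n → M) → M}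
    (hs : IsTerm fun w : Fin (n + 1) → M => s (w 0) fun i => w i.succ)
    (ht : IsTerm fun w : Fin (n + 1) → M => t (w 0) fun i => w i.succ)
    (zero : s 0 v = t 0 v) (succ : ∀ x, s x v = t x v → s (x + 1) v = t (x + 1) v) (x : M) :
    s x v = t x v :=
  hS.def0_induction v (Q := fun x v => s x v = t x v) (Def0.eq hS.sets_nonempty hs ht) zero succ x

protected theorem zero_add (hS : ModelsRCA0 S) (x : M) : 0 + x = x :=
  hS.eq_induction ![] (s := fun x _ => 0 + x) (t := fun x _ => x)
    (IsTerm.zero.add (.var 0)) (.var 0) (hS.add_zero 0) (fun x h => by simp only [hS.add_succ, h]) x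

theorem succ_add (hS : ModelsRCA0 S) (m x : M) : m + 1 + x = m + x + 1 :=
  hS.eq_induction ![m] (s := fun x v => v 0 + 1 + x) (t := fun x v => v 0 + x + 1)
    (((IsTerm.var 1).add .one).add (.var 0)) (((IsTerm.var 1).add (.var 0)).add .one)
    (by simp only [hS.add_zero]) (fun x h => by simp only [hS.add_succ, h]) x

protected theorem add_comm (hS : ModelsRCA0 S) (m x : M) : m + x = x + m :=
  hS.eq_induction ![m] (s := fun x v => v 0 + x) (t := fun x v => x + v 0)
    ((IsTerm.var 1).add (.var 0)) ((IsTerm.var 0).add (.var 1))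
    (by simp only [hS.add_zero, hS.zero_add])
    (fun x h => by simp only [hS.add_succ, h, hS.succ_add]) x

protected theorem add_assoc (hS : ModelsRCA0 S) (a b x : M) : a + b + x = a + (b + x) :=
  hS.eq_induction ![a, b] (s := fun x v => v 0 + v 1 + x) (t := fun x v => v 0 + (v 1 + x))
    (((IsTerm.var 1).add (.var 2)).add (.var 0)) ((IsTerm.var 1).add ((IsTerm.var 2).add (.var 0)))
    (by simp only [hS.add_zero]) (fun x h => by simp only [hS.add_succ, h]) x

protected theorem zero_mul (hS : ModelsRCA0 S) (x : M) : 0 * x = 0 :=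
  hS.eq_induction ![] (s := fun x _ => 0 * x) (t := fun _ _ => 0) (IsTerm.zero.mul (.var 0)) .zero
    (hS.mul_zero 0) (fun x h => by simp only [hS.mul_succ, h, hS.add_zero]) x

protected theorem add_add_add_comm (hS : ModelsRCA0 S) (a b c d : M) :
    a + b + (c + d) = a + c + (b + d) := by
  rw [hS.add_assoc, ← hS.add_assoc b, hS.add_comm b c, hS.add_assoc c, ← hS.add_assoc]

theorem succ_mul (hS : ModelsRCA0 S) (m x : M) : (m + 1) * x = m * x + x :=
  hS.eq_induction ![m] (s := fun x v => (v 0 + 1) * x) (t := fun x v => v 0 * x + x)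
    (((IsTerm.var 1).add .one).mul (.var 0)) (((IsTerm.var 1).mul (.var 0)).add (.var 0))
    (by simp only [hS.mul_zero, hS.add_zero])
    (fun x h => by simp only [hS.mul_succ, h]; exact hS.add_add_add_comm _ _ _ _) x

protected theorem mul_comm (hS : ModelsRCA0 S) (m x : M) : m * x = x * m :=
  hS.eq_induction ![m] (s := fun x v => v 0 * x) (t := fun x v => x * v 0)
    ((IsTerm.var 1).mul (.var 0)) ((IsTerm.var 0).mul (.var 1))
    (by simp only [hS.mul_zero, hS.zero_mul])
    (fun x h => by simp only [hS.mul_succ, h, hS.succ_mul]) x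

protected theorem mul_add (hS : ModelsRCA0 S) (a b x : M) : a * (b + x) = a * b + a * x :=
  hS.eq_induction ![a, b] (s := fun x v => v 0 * (v 1 + x)) (t := fun x v => v 0 * v 1 + v 0 * x)
    ((IsTerm.var 1).mul ((IsTerm.var 2).add (.var 0)))
    (((IsTerm.var 1).mul (.var 2)).add ((IsTerm.var 1).mul (.var 0)))
    (by simp only [hS.add_zero, hS.mul_zero])
    (fun x h => by simp only [hS.add_succ, hS.mul_succ, h]; exact hS.add_assoc _ _ _) x

protected theorem mul_assoc (hS : ModelsRCA0 S) (a b x : M) : a * b * x = a * (b * x) :=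
  hS.eq_induction ![a, b] (s := fun x v => v 0 * v 1 * x) (t := fun x v => v 0 * (v 1 * x))
    (((IsTerm.var 1).mul (.var 2)).mul (.var 0)) ((IsTerm.var 1).mul ((IsTerm.var 2).mul (.var 0)))
    (by simp only [hS.mul_zero]) (fun x h => by simp only [hS.mul_succ, h, hS.mul_add]) x

protected theorem mul_one (hS : ModelsRCA0 S) (a : M) : a * 1 = a := by
  rw [← hS.zero_add 1, hS.mul_succ, hS.mul_zero, hS.zero_add]

protected theorem add_left_cancel (hS : ModelsRCA0 S) (a x y : M) : a + x = a + y → x = y :=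
  hS.def0_induction ![x, y] (Q := fun a v => a + v 0 = a + v 1 → v 0 = v 1)
    (.imp (.eq hS.sets_nonempty ((IsTerm.var 0).add (.var 1)) ((IsTerm.var 0).add (.var 2)))
      (.eq hS.sets_nonempty (.var 1) (.var 2)))
    (by simp only [hS.zero_add, imp_self])
    (fun a h e => h (hS.succ_inj _ _ (by simpa only [hS.succ_add] using e))) a

theorem lt_add_succ (hS : ModelsRCA0 S) (a d : M) : a < a + d + 1 :=
  hS.def0_induction ![a] (Q := fun d v => v 0 < v 0 + d + 1)
    (.lt hS.sets_nonempty (.var 1) (((IsTerm.var 1).add (.var 0)).add .one))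
    (by simp only [hS.add_zero]; exact (hS.lt_succ _ _).2 (.inr rfl))
    (fun d h => (hS.lt_succ _ _).2 (.inl (by simpa only [hS.add_succ] using h))) d

theorem lt_iff (hS : ModelsRCA0 S) (a b : M) : a < b ↔ ∃ d, b = a + d + 1 := by
  constructor
  · refine hS.sig_induction ![a] (Q := fun b v => v 0 < b → ∃ d, b = v 0 + d + 1)
      ⟨fun w => w 2 < w 1 → w 1 = w 2 + w 0 + 1,
        .imp (.lt hS.sets_nonempty (.var 2) (.var 1))
          (.eq hS.sets_nonempty (.var 1) (((IsTerm.var 2).add (.var 0)).add .one)),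
        fun v => by
          have : Nonempty M := ⟨0⟩
          change (v 1 < v 0 → ∃ d, v 0 = v 1 + d + 1) ↔ ∃ d, v 1 < v 0 → v 0 = v 1 + d + 1
          by_cases h : v 1 < v 0 <;> simp [h]⟩ (fun h => (hS.not_lt_zero _ h).elim) ?_ b
    intro x ih h
    rcases (hS.lt_succ _ _).1 h with h | h
    · obtain ⟨d, hd⟩ := ih h
      exact ⟨d + 1, by simp only [hS.add_succ]; exact congrArg (· + 1) hd⟩
    · exact ⟨0, by rw [hS.add_zero, ← h]⟩
  · rintro ⟨d, rfl⟩
    exact hS.lt_add_succ a d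

protected theorem lt_irrefl (hS : ModelsRCA0 S) (a : M) : ¬ a < a := by
  intro h
  obtain ⟨d, hd⟩ := (hS.lt_iff a a).1 h
  refine hS.succ_ne_zero d (hS.add_left_cancel a _ _ ?_).symm
  rw [hS.add_zero, hS.add_succ]
  exact hd

protected theorem lt_trans (hS : ModelsRCA0 S) {a b c : M} (h : a < b) (h' : b < c) : a < c := by
  obtain ⟨d, rfl⟩ := (hS.lt_iff _ _).1 h
  obtain ⟨e, rfl⟩ := (hS.lt_iff _ _).1 h'
  refine (hS.lt_iff _ _).2 ⟨d + 1 + e, ?_⟩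
  simp only [hS.add_assoc]

theorem eq_zero_or_eq_succ (hS : ModelsRCA0 S) (x : M) : x = 0 ∨ ∃ y, x = y + 1 := by
  have h : 0 < x + 1 := hS.lt_iff _ _ |>.2 ⟨x, by rw [hS.zero_add]⟩
  rcases (hS.lt_succ _ _).1 h with h | h
  · obtain ⟨d, hd⟩ := (hS.lt_iff _ _).1 h
    exact .inr ⟨d, by rw [hd, hS.zero_add]⟩
  · exact .inl h.symm

protected theorem lt_trichotomy (hS : ModelsRCA0 S) (a b : M) : a < b ∨ a = b ∨ b < a := by
  refine hS.def0_induction ![a] (Q := fun b v => v 0 < b ∨ v 0 = b ∨ b < v 0)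
    (.or (.lt hS.sets_nonempty (.var 1) (.var 0)) (.or (.eq hS.sets_nonempty (.var 1) (.var 0))
      (.lt hS.sets_nonempty (.var 0) (.var 1)))) ?_ ?_ b
  · rcases hS.eq_zero_or_eq_succ a with rfl | ⟨y, rfl⟩
    · exact .inr (.inl rfl)
    · exact .inr (.inr ((hS.lt_iff _ _).2 ⟨y, by simp [hS.zero_add]⟩))
  · rintro x (h | h | h)
    · exact .inl ((hS.lt_succ _ _).2 (.inl h))
    · exact .inl ((hS.lt_succ _ _).2 (.inr h))
    · obtain ⟨d, hd⟩ := (hS.lt_iff _ _).1 h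
      rcases hS.eq_zero_or_eq_succ d with rfl | ⟨e, rfl⟩
      · exact .inr (.inl (by rw [hd, hS.add_zero]))
      · exact .inr (.inr ((hS.lt_iff _ _).2 ⟨e, by rw [hd, hS.succ_add, hS.add_succ]⟩))

/-- The numbers of a model form a commutative semiring. -/
abbrev commSemiring (hS : ModelsRCA0 S) : CommSemiring M where
  add_assoc := hS.add_assoc
  zero_add := hS.zero_add
  add_zero := hS.add_zero
  add_comm := hS.add_comm
  mul_assoc := hS.mul_assoc
  one_mul x := by rw [hS.mul_comm, hS.mul_one]
  mul_one := hS.mul_one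
  zero_mul := hS.zero_mul
  mul_zero := hS.mul_zero
  mul_comm := hS.mul_comm
  left_distrib := hS.mul_add
  right_distrib a b c := by rw [hS.mul_comm, hS.mul_add, hS.mul_comm c, hS.mul_comm c]
  nsmul := nsmulRec
  npow := npowRec

open Classical in
/-- The numbers of a model are linearly ordered by `<`. -/
noncomputable abbrev linearOrder (hS : ModelsRCA0 S) : LinearOrder M where
  le a b := a < b ∨ a = b
  le_refl _ := .inr rfl
  le_trans a b c := by
    rintro (h | rfl) (h' | rfl)
    exacts [.inl (hS.lt_trans h h'), .inl h, .inl h', .inr rfl]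
  lt_iff_le_not_ge a b := by
    refine ⟨fun h => ⟨.inl h, ?_⟩, ?_⟩
    · rintro (h' | rfl)
      exacts [hS.lt_irrefl _ (hS.lt_trans h h'), hS.lt_irrefl _ h]
    · rintro ⟨h | rfl, h'⟩
      exacts [h, (h' (.inr rfl)).elim]
  le_antisymm a b := by
    rintro (h | rfl) (h' | h')
    exacts [(hS.lt_irrefl _ (hS.lt_trans h h')).elim, h'.symm, rfl, rfl]
  le_total a b := by
    rcases hS.lt_trichotomy a b with h | h | h
    exacts [.inl (.inl h), .inl (.inr h), .inr (.inl h)]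
  toDecidableLE := Classical.decRel _

theorem isStrictOrderedRing (hS : ModelsRCA0 S) :
    letI := hS.commSemiring
    letI := hS.linearOrder
    IsStrictOrderedRing M := by
  let := hS.commSemiring
  let := hS.linearOrder
  have add_lt {a b : M} (h : a < b) (c : M) : a + c < b + c := by
    obtain ⟨d, rfl⟩ := (hS.lt_iff _ _).1 h
    exact (hS.lt_iff _ _).2 ⟨d, by ring⟩
  have mul_lt {a b c : M} (hc : 0 < c) (h : a < b) : c * a < c * b := by
    obtain ⟨d, rfl⟩ := (hS.lt_iff _ _).1 h
    obtain ⟨e, rfl⟩ := (hS.lt_iff _ _).1 hc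
    exact (hS.lt_iff _ _).2 ⟨e * d + e + d, by ring⟩
  have add_le (a b : M) (h : a ≤ b) (c : M) : a + c ≤ b + c := by
    rcases h with h | rfl
    exacts [.inl (add_lt h c), .inr rfl]
  exact
    { add_le_add_left := add_le
      le_of_add_le_add_left := fun a b c h => by
        by_contra! h'
        have := add_lt h' a
        rw [hS.add_comm c, hS.add_comm b] at this
        exact absurd h (not_le.2 this)
      zero_le_one := .inl ((hS.lt_iff _ _).2 ⟨0, by ring⟩)
      exists_pair_ne := ⟨1, 0, by simpa only [hS.zero_add] using hS.succ_ne_zero 0⟩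
      mul_lt_mul_of_pos_left := fun c hc a b h => mul_lt hc h
      mul_lt_mul_of_pos_right := fun c hc a b h => by
        rw [hS.mul_comm a, hS.mul_comm b]
        exact mul_lt hc h }

theorem canonicallyOrderedAdd (hS : ModelsRCA0 S) :
    letI := hS.commSemiring
    letI := hS.linearOrder
    CanonicallyOrderedAdd M := by
  let := hS.commSemiring
  let := hS.linearOrder
  have h (a b : M) : a ≤ a + b := by
    rcases hS.eq_zero_or_eq_succ b with rfl | ⟨b, rfl⟩
    · exact .inr (hS.add_zero a).symm
    · exact .inl ((hS.lt_iff _ _).2 ⟨b, hS.add_succ _ _⟩)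
  exact
    { exists_add_of_le := by
        rintro a b (h | rfl)
        · obtain ⟨d, rfl⟩ := (hS.lt_iff _ _).1 h
          exact ⟨d + 1, hS.add_assoc _ _ _⟩
        · exact ⟨0, (hS.add_zero a).symm⟩
      le_self_add := h
      le_add_self := fun a b => hS.add_comm a b ▸ h a b }

end ModelsRCA0

end Arithmetic

section OrderedModel

set_option linter.unusedSectionVars false

variable {M : Type u} [CommSemiring M] [LinearOrder M] [IsStrictOrderedRing M]
  [CanonicallyOrderedAdd M] {S : Set (Set M)} {n : ℕ}

namespace ModelsRCA0

theorem lt_add_one_iff (hS : ModelsRCA0 S) {a b : M} : a < b + 1 ↔ a ≤ b := by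
  rw [hS.lt_succ, le_iff_lt_or_eq]

theorem add_one_le_iff (hS : ModelsRCA0 S) {a b : M} : a + 1 ≤ b ↔ a < b := by
  rw [← not_lt, hS.lt_add_one_iff, not_le]

theorem le_mul_self (hS : ModelsRCA0 S) (a : M) : a ≤ a * a := by
  rcases eq_or_ne a 0 with rfl | h
  · simp
  · exact le_mul_of_one_le_left' (by simpa using hS.add_one_le_iff.2 (pos_iff_ne_zero.2 h))

theorem le_mul_right (hS : ModelsRCA0 S) {a b : M} (hb : b ≠ 0) : a ≤ a * b :=
  le_mul_of_one_le_right zero_le (by simpa using hS.add_one_le_iff.2 (pos_iff_ne_zero.2 hb))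

theorem left_le_pair (a b : M) : a ≤ pair a b := le_add_self

theorem right_le_pair (hS : ModelsRCA0 S) (a b : M) : b ≤ pair a b :=
  le_add_self.trans ((hS.le_mul_self (a + b)).trans le_self_add)

theorem pair_lt_pair (hS : ModelsRCA0 S) {a b c d : M} (h : a + b < c + d) :
    pair a b < pair c d := by
  have h1 : a + b + 1 ≤ c + d := hS.add_one_le_iff.2 h
  calc pair a b < (a + b + 1) * (a + b + 1) := by
        rw [pair, show (a + b + 1) * (a + b + 1) = (a + b) * (a + b) + a + (a + b + b) + 1 by ring,
          hS.lt_add_one_iff]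
        exact le_self_add
    _ ≤ (c + d) * (c + d) := mul_le_mul' h1 h1
    _ ≤ pair c d := le_self_add

/-- The squares of consecutive sums leave room for the first component. -/
theorem pair_inj (hS : ModelsRCA0 S) {a b c d : M} : pair a b = pair c d ↔ a = c ∧ b = d := by
  refine ⟨fun h => ?_, fun ⟨h, h'⟩ => by rw [h, h']⟩
  rcases lt_trichotomy (a + b) (c + d) with h' | h' | h'
  · exact absurd h (hS.pair_lt_pair h').ne
  · obtain rfl : a = c := by
      rw [pair, pair, h'] at h
      exact add_left_cancel h
    exact ⟨rfl, add_left_cancel h'⟩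
  · exact absurd h (hS.pair_lt_pair h').ne'

end ModelsRCA0

/-! ### `Σ⁰₁` predicates and recursive comprehension -/

/-- Two unbounded existential quantifiers are merged by bounding both witnesses. -/
theorem Sig.ex (hS : ModelsRCA0 S) {P : M → (Fin n → M) → Prop}
    (hP : Sig S fun w : Fin (n + 1) → M => P (w 0) fun i => w i.succ) :
    Sig S fun v => ∃ x, P x v := by
  obtain ⟨Q, hQ, h⟩ := hP
  refine ⟨fun w => ∃ x, x < w 0 + 1 ∧ ∃ y, y < w 0 + 1 ∧
    Q (Fin.cons y (Fin.cons x fun i => w i.succ)), ?_, fun v => ?_⟩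
  · refine .bex ((IsTerm.var 0).add .one) (.bex ((IsTerm.var 1).add .one) ?_)
    refine (hQ.subst (σ := (Fin.cons (fun w => w 0) (Fin.cons (fun w => w 1)
      fun i w => w i.succ.succ.succ) : Fin (n + 2) → (Fin (n + 3) → M) → M)) ?_).congr fun v => ?_
    · refine Fin.cases (.var 0) (Fin.cases (.var 1) fun i => .var i.succ.succ.succ)
    · refine iff_of_eq (congrArg Q (funext ?_))
      refine Fin.cases rfl (Fin.cases rfl fun i => rfl)
  · have h' : ∀ x, P x v ↔ ∃ y, Q (Fin.cons y (Fin.cons x v)) := fun x => by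
      rw [← h]
      simp
    simp only [h', Fin.cons_zero, Fin.cons_succ]
    constructor
    · rintro ⟨x, y, hxy⟩
      exact ⟨x + y, x, hS.lt_add_one_iff.2 le_self_add, y, hS.lt_add_one_iff.2 le_add_self, hxy⟩
    · rintro ⟨_, x, _, y, _, hxy⟩
      exact ⟨x, y, hxy⟩

theorem Sig.congr {P Q : (Fin n → M) → Prop} (hP : Sig S P) (h : ∀ v, P v ↔ Q v) : Sig S Q := by
  obtain rfl : P = Q := funext fun v => propext (h v)
  exact hP

theorem Sig.or {P Q : (Fin n → M) → Prop} (hP : Sig S P) (hQ : Sig S Q) :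
    Sig S fun v => P v ∨ Q v := by
  obtain ⟨P', hP, h⟩ := hP
  obtain ⟨Q', hQ, h'⟩ := hQ
  exact ⟨_, hP.or hQ, fun v => by simp only [h, h', exists_or]⟩

theorem Sig.and (hS : ModelsRCA0 S) {P Q : (Fin n → M) → Prop} (hP : Sig S P) (hQ : Sig S Q) :
    Sig S fun v => P v ∧ Q v := by
  obtain ⟨P', hP, h⟩ := hP
  obtain ⟨Q', hQ, h'⟩ := hQ
  have hP' : Def0 S fun w : Fin (n + 2) → M => P' fun i => w i.succ := hP.subst fun i => .var _
  have hQ' : Def0 S fun w : Fin (n + 2) → M => Q' (Fin.cons (w 0) fun i => w i.succ.succ) := by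
    refine (hQ.subst (σ := (Fin.cons (fun w => w 0) fun i w => w i.succ.succ :
      Fin (n + 1) → (Fin (n + 2) → M) → M)) ?_).congr fun v => ?_
    · exact Fin.cases (.var 0) fun i => .var _
    · refine iff_of_eq (congrArg Q' (funext ?_))
      exact Fin.cases rfl fun i => rfl
  refine (Sig.ex hS (P := fun x v => ∃ y, P' (Fin.cons x v) ∧ Q' (Fin.cons y v))
    ⟨_, hP'.and hQ', fun v => ?_⟩).congr fun v => ?_
  · refine exists_congr fun y => and_congr (iff_of_eq (congrArg P' (funext ?_))) ?_
    · exact Fin.cases rfl fun i => rfl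
    · simp
  · simp only [h, h']
    constructor
    · rintro ⟨x, y, hx, hy⟩
      exact ⟨⟨x, hx⟩, y, hy⟩
    · rintro ⟨⟨x, hx⟩, y, hy⟩
      exact ⟨x, y, hx, hy⟩

theorem Sig.subst {m : ℕ} {P : (Fin n → M) → Prop} (hP : Sig S P) {σ : Fin n → (Fin m → M) → M}
    (hσ : ∀ i, IsTerm (σ i)) : Sig S fun v => P fun i => σ i v := by
  obtain ⟨Q, hQ, h⟩ := hP
  refine ⟨_, hQ.subst (σ := (Fin.cons (fun w => w 0) fun i w => σ i fun j => w j.succ :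
    Fin (n + 1) → (Fin (m + 1) → M) → M)) (Fin.cases (.var 0) fun i => (hσ i).shift), fun v => ?_⟩
  refine (h _).trans (exists_congr fun y => iff_of_eq (congrArg Q (funext ?_)))
  exact Fin.cases rfl fun i => rfl

namespace ModelsRCA0

/-- The least number principle for bounded formulas. -/
theorem exists_least (hS : ModelsRCA0 S) {P : M → (Fin n → M) → Prop}
    (hP : Def0 S fun w : Fin (n + 1) → M => P (w 0) fun i => w i.succ) (v : Fin n → M)
    (h : ∃ y, P y v) : ∃ y, P y v ∧ ∀ z, z < y → ¬ P z v := by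
  by_contra! H
  have key : ∀ x, ∀ y, y < x → ¬ P y v := by
    refine hS.def0_induction v (Q := fun x v => ∀ y, y < x → ¬ P y v) (.ball (.var 0) ?_)
      (fun y hy => absurd hy (hS.not_lt_zero y)) fun x ih y hy hPy => ?_
    · refine ((hP.subst (σ := (Fin.cons (fun w => w 0) fun i w => w i.succ.succ :
        Fin (n + 1) → (Fin (n + 2) → M) → M)) ?_).congr fun v => ?_).not
      · exact Fin.cases (.var 0) fun i => .var _
      · exact Iff.rfl
    · obtain ⟨z, hz, hz'⟩ := H y hPy
      exact ih z (hz.trans_le (hS.lt_add_one_iff.1 hy)) hz'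
  obtain ⟨y, hy⟩ := h
  exact key (y + 1) y (hS.lt_add_one_iff.2 le_rfl) hy

/-- `Δ⁰₁` comprehension, with number parameters `v`. -/
theorem comprehension (hS : ModelsRCA0 S) {P P' : M → (Fin n → M) → Prop}
    (hP : Sig S fun w : Fin (n + 1) → M => P (w 0) fun i => w i.succ)
    (hP' : Sig S fun w : Fin (n + 1) → M => P' (w 0) fun i => w i.succ) (v : Fin n → M)
    (h : ∀ x, P' x v ↔ ¬ P x v) : {x | P x v} ∈ S := by
  obtain ⟨R, hR0, hR⟩ := hP
  obtain ⟨R', hR0', hR'⟩ := hP'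
  obtain ⟨W, hW, θ, η, hθ, hη⟩ := hR0.common hR0'.not
  have key : ∀ x, (∃ y, θ.Holds W (Fin.cons y (Fin.cons x v))) ↔ P x v := fun x => by
    simp only [hθ]
    rw [← hR]
    simp
  have key' : ∀ x, (∀ y, η.Holds W (Fin.cons y (Fin.cons x v))) ↔ P x v := fun x => by
    simp only [hη]
    rw [← not_exists, ← hR', ← not_iff_not, not_not]
    simpa using h x
  have := hS.delta_comprehension θ η W v hW fun x => by rw [key, key']
  simpa only [key] using this

theorem comprehension_def0 (hS : ModelsRCA0 S) {P : M → (Fin n → M) → Prop}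
    (hP : Def0 S fun w : Fin (n + 1) → M => P (w 0) fun i => w i.succ) (v : Fin n → M) :
    {x | P x v} ∈ S :=
  have : Nonempty M := ⟨0⟩
  hS.comprehension (P' := fun x v => ¬ P x v) hP.sig hP.not.sig v fun _ => Iff.rfl

/-- Uniformization: a total `Σ⁰₁` relation contains the graph of a function of the model. The value
at `x` is the first component of the least pair consisting of a value and a witness for it. -/
theorem exists_seq (hS : ModelsRCA0 S) {R : M → M → (Fin n → M) → Prop}
    (hR : Sig S fun w : Fin (n + 2) → M => R (w 0) (w 1) fun i => w i.succ.succ) (v : Fin n → M)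
    (h : ∀ x, ∃ y, R x y v) : ∃ f, IsSeq S f ∧ ∀ x, R x (f x) v := by
  obtain ⟨Q, hQ, hRQ⟩ := hR
  have : Nonempty M := ⟨0⟩
  -- `E u (x, v)`: `u` is a pair of a value at `x` and a witness for it.
  let E : M → (Fin (n + 1) → M) → Prop := fun u w =>
    ∃ y, y < u + 1 ∧ ∃ z, z < u + 1 ∧ u = pair y z ∧
      Q (Fin.cons z (Fin.cons (w 0) (Fin.cons y fun i => w i.succ)))
  have hE : ∀ {m : ℕ} {s : (Fin m → M) → M} {t : Fin (n + 1) → (Fin m → M) → M}, IsTerm s →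
      (∀ i, IsTerm (t i)) → Def0 S fun w => E (s w) fun i => t i w := by
    intro m s t hs ht
    refine .bex (hs.add .one) (.bex (hs.shift.add .one)
      (.and (.eq hS.sets_nonempty hs.shift.shift (.pair (.var 1) (.var 0))) ?_))
    refine (hQ.subst (σ := (Fin.cons (fun w => w 0) (Fin.cons (fun w => t 0 fun i => w i.succ.succ)
      (Fin.cons (fun w => w 1) fun i w => t i.succ fun i => w i.succ.succ)) :
      Fin (n + 3) → (Fin (m + 2) → M) → M)) ?_).congr fun w => ?_
    · exact Fin.cases (.var 0) (Fin.cases (ht 0).shift.shift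
        (Fin.cases (.var 1) fun i => (ht _).shift.shift))
    · refine iff_of_eq (congrArg Q (funext ?_))
      exact Fin.cases rfl (Fin.cases rfl (Fin.cases rfl fun i => rfl))
  -- `G u (x, v)`: `u` is the least such pair.
  let G : M → (Fin (n + 1) → M) → Prop := fun u w => E u w ∧ ∀ u', u' < u → ¬ E u' w
  have hG : ∀ {m : ℕ} {s : (Fin m → M) → M} {t : Fin (n + 1) → (Fin m → M) → M}, IsTerm s →
      (∀ i, IsTerm (t i)) → Def0 S fun w => G (s w) fun i => t i w := fun hs ht =>
    (hE hs ht).and (.ball hs (hE (.var 0) fun i => (ht i).shift).not)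
  have hex : ∀ x, ∃ u, G u (Fin.cons x v) := by
    intro x
    refine hS.exists_least (P := E) (hE (.var 0) fun i => .var _) _ ?_
    obtain ⟨y, hy⟩ := h x
    obtain ⟨z, hz⟩ := (hRQ (Fin.cons x (Fin.cons y v))).1 (by simpa using hy)
    exact ⟨pair y z, y, hS.lt_add_one_iff.2 (left_le_pair _ _), z,
      hS.lt_add_one_iff.2 (hS.right_le_pair _ _), rfl, by simpa using hz⟩
  have huniq : ∀ {u u' w}, G u w → G u' w → u = u' := by
    intro u u' w hu hu'
    rcases lt_trichotomy u u' with h | h | h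
    exacts [absurd hu.1 (hu'.2 _ h), h, absurd hu'.1 (hu.2 _ h)]
  choose g hg using hex
  have hg' : ∀ x, ∃ y z, g x = pair y z ∧ R x y v := by
    intro x
    obtain ⟨y, _, z, _, h1, h2⟩ := (hg x).1
    refine ⟨y, z, h1, ?_⟩
    have := (hRQ (Fin.cons x (Fin.cons y v))).2 ⟨z, by simpa using h2⟩
    simpa using this
  choose f k hfk hfR using hg'
  refine ⟨f, ?_, hfR⟩
  have hGr : ∀ x u, G u (Fin.cons x v) ↔ u = g x := fun x u =>
    ⟨fun h => huniq h (hg x), fun h => h ▸ hg x⟩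
  -- Membership in the graph and its negation are both `Σ⁰₁`, because `G` is the graph of a function.
  let P : M → (Fin n → M) → Prop := fun p v =>
    ∃ x y z, p = pair x y ∧ G (pair y z) (Fin.cons x v)
  let P' : M → (Fin n → M) → Prop := fun p v =>
    (∀ x, x < p + 1 → ∀ y, y < p + 1 → p ≠ pair x y) ∨
    ∃ x y u, p = pair x y ∧ G u (Fin.cons x v) ∧ ∀ z, z < u + 1 → u ≠ pair y z
  have hcons : ∀ {m : ℕ} {s : (Fin m → M) → M} {t : Fin n → (Fin m → M) → M} (j : Fin m),
      IsTerm s → (∀ i, IsTerm (t i)) →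
      Def0 S fun w => G (s w) (Fin.cons (w j) fun i => t i w) := by
    intro m s t j hs ht
    refine (hG hs (t := Fin.cons (fun w => w j) t) ?_).congr fun w => ?_
    · exact Fin.cases (.var j) ht
    · have e : (fun i => (Fin.cons (fun w => w j) t : Fin (n + 1) → (Fin m → M) → M) i w) =
          Fin.cons (w j) fun i => t i w := funext (Fin.cases rfl fun i => rfl)
      rw [e]
  have hP : Sig S fun w : Fin (n + 1) → M => P (w 0) fun i => w i.succ := by
    refine Sig.ex hS (Sig.ex hS (Sig.ex hS (Def0.sig (.and ?_ ?_))))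
    · exact .eq hS.sets_nonempty (.var 3) (.pair (.var 2) (.var 1))
    · exact hcons 2 (.pair (.var 1) (.var 0)) fun i => .var _
  have hP' : Sig S fun w : Fin (n + 1) → M => P' (w 0) fun i => w i.succ := by
    refine .or (Def0.sig (.ball ((IsTerm.var 0).add .one) (.ball ((IsTerm.var 1).add .one)
      (.ne hS.sets_nonempty (.var 2) (.pair (.var 1) (.var 0))))))
      (Sig.ex hS (Sig.ex hS (Sig.ex hS (Def0.sig (.and ?_ (.and ?_ ?_))))))
    · exact .eq hS.sets_nonempty (.var 3) (.pair (.var 2) (.var 1))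
    · exact hcons 2 (.var 0) fun i => .var _
    · exact .ball ((IsTerm.var 0).add .one)
        (.ne hS.sets_nonempty (.var 1) (.pair (.var 2) (.var 0)))
  have hPiff : ∀ p, P p v ↔ ∃ x, p = pair x (f x) := by
    intro p
    constructor
    · rintro ⟨x, y, z, rfl, hz⟩
      rw [hGr, hfk, hS.pair_inj] at hz
      exact ⟨x, by rw [hz.1]⟩
    · rintro ⟨x, rfl⟩
      exact ⟨x, f x, k x, rfl, (hGr _ _).2 (hfk x).symm⟩
  have := hS.comprehension hP hP' v fun p => ?_
  · simp only [hPiff] at this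
    exact this
  · rw [hPiff]
    constructor
    · rintro (h | ⟨x, y, u, rfl, hu, h⟩) ⟨x', hx'⟩
      · exact h x' (hS.lt_add_one_iff.2 (hx' ▸ left_le_pair _ _)) (f x')
          (hS.lt_add_one_iff.2 (hx' ▸ hS.right_le_pair _ _)) hx'
      · obtain ⟨rfl, rfl⟩ := hS.pair_inj.1 hx'
        rw [hGr] at hu
        subst hu
        exact h (k x) (hS.lt_add_one_iff.2 (hfk x ▸ hS.right_le_pair _ _)) (hfk x)
    · intro h
      by_cases hp : ∃ x y, p = pair x y
      · obtain ⟨x, y, rfl⟩ := hp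
        refine .inr ⟨x, y, g x, rfl, hg x, fun z _ hz => h ⟨x, ?_⟩⟩
        rw [hfk, hS.pair_inj] at hz
        rw [hz.1]
      · exact .inl fun x _ y _ hxy => hp ⟨x, y, hxy⟩

end ModelsRCA0

/-! ### Sequences of the model -/

theorem Def0.seq (hS : ModelsRCA0 S) {f : M → M} (hf : IsSeq S f) {s t : (Fin n → M) → M}
    (hs : IsTerm s) (ht : IsTerm t) : Def0 S fun v => t v = f (s v) :=
  (Def0.mem hf (hs.pair ht)).congr fun v => by
    constructor
    · rintro ⟨x, hx⟩
      obtain ⟨h, h'⟩ := hS.pair_inj.1 hx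
      rw [h, h']
    · intro h
      exact ⟨s v, by rw [h]⟩

theorem Def0.doubleSeq (hS : ModelsRCA0 S) {f : M → M → M} (hf : IsDoubleSeq S f)
    {r s t : (Fin n → M) → M} (hr : IsTerm r) (hs : IsTerm s) (ht : IsTerm t) :
    Def0 S fun v => t v = f (r v) (s v) :=
  (Def0.mem hf ((hr.pair hs).pair ht)).congr fun v => by
    constructor
    · rintro ⟨x, y, hx⟩
      obtain ⟨h, h'⟩ := hS.pair_inj.1 hx
      obtain ⟨h, h''⟩ := hS.pair_inj.1 h
      rw [h, h', h'']
    · intro h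
      exact ⟨r v, s v, by rw [h]⟩

/-- `c` is not a pair. The components of a pair are at most the pair, so that it is enough to search
below `c + 1`, which makes this a bounded formula. -/
def NotPair (c : M) : Prop := ∀ x, x < c + 1 → ∀ y, y < c + 1 → c ≠ pair x y

theorem notPair_or_exists (c : M) : NotPair c ∨ ∃ x y, c = pair x y := by
  by_contra! h
  exact h.1 fun x _ y _ => h.2 x y

theorem ModelsRCA0.not_notPair (hS : ModelsRCA0 S) (x y : M) : ¬ NotPair (pair x y) := fun h =>
  h x (hS.lt_add_one_iff.2 (ModelsRCA0.left_le_pair _ _)) y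
    (hS.lt_add_one_iff.2 (hS.right_le_pair _ _)) rfl

theorem Def0.notPair (hS : ModelsRCA0 S) {t : (Fin n → M) → M} (ht : IsTerm t) :
    Def0 S fun v => NotPair (t v) :=
  .ball (ht.add .one) (.ball (ht.shift.add .one)
    (.ne hS.sets_nonempty ht.shift.shift (.pair (.var 1) (.var 0))))

/-- Uniformization of a total `Σ⁰₁` relation by a double sequence. -/
theorem ModelsRCA0.exists_doubleSeq (hS : ModelsRCA0 S) {R : M → M → M → Prop}
    (hR : Sig S fun w : Fin 3 → M => R (w 0) (w 1) (w 2)) (h : ∀ x y, ∃ z, R x y z) :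
    ∃ f, IsDoubleSeq S f ∧ ∀ x y, R x y (f x y) := by
  obtain ⟨f, hf, hfR⟩ := hS.exists_seq (n := 0)
    (R := fun c z _ => (∃ x y, c = pair x y ∧ R x y z) ∨ NotPair c)
    (.or (Sig.ex hS (Sig.ex hS (.and hS
      (Def0.sig (.eq hS.sets_nonempty (.var 2) (.pair (.var 1) (.var 0))))
      (hR.subst (σ := ![fun w => w 1, fun w => w 0, fun w => w 3])
        (Fin.cases (.var 1) (Fin.cases (.var 0) (Fin.cases (.var 3) (Fin.elim0 ·))))))))
      (Def0.sig (.notPair hS (.var 0)))) ![] fun c => by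
        rcases notPair_or_exists c with hc | ⟨x, y, rfl⟩
        · exact ⟨0, .inr hc⟩
        · obtain ⟨z, hz⟩ := h x y
          exact ⟨z, .inl ⟨x, y, rfl, hz⟩⟩
  refine ⟨fun x y => f (pair x y), ?_, fun x y => ?_⟩
  · have := hS.comprehension_def0 (n := 0) (P := fun c _ => ∃ x, x < c + 1 ∧ ∃ y, y < c + 1 ∧
      ∃ z, z < c + 1 ∧ c = pair (pair x y) z ∧ z = f (pair x y))
      (.bex ((IsTerm.var 0).add .one) (.bex ((IsTerm.var 1).add .one)
        (.bex ((IsTerm.var 2).add .one) (.and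
          (.eq hS.sets_nonempty (.var 3) (((IsTerm.var 2).pair (.var 1)).pair (.var 0)))
          (.seq hS hf ((IsTerm.var 2).pair (.var 1)) (.var 0)))))) ![]
    refine (congrArg (· ∈ S) (Set.ext fun c => ?_)).mpr this
    constructor
    · rintro ⟨x, y, rfl⟩
      have h1 := left_le_pair (pair x y) (f (pair x y))
      exact ⟨x, hS.lt_add_one_iff.2 ((left_le_pair _ _).trans h1), y,
        hS.lt_add_one_iff.2 ((hS.right_le_pair _ _).trans h1), _,
        hS.lt_add_one_iff.2 (hS.right_le_pair _ _), rfl, rfl⟩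
    · rintro ⟨x, _, y, _, z, _, h, rfl⟩
      exact ⟨x, y, h⟩
  · rcases hfR (pair x y) with ⟨x', y', h, hR⟩ | h
    · obtain ⟨rfl, rfl⟩ := hS.pair_inj.1 h
      exact hR
    · exact absurd h (hS.not_notPair x y)

/-! ### Coding of finite sets -/

namespace ModelsRCA0

theorem finMem_pair_iff (hS : ModelsRCA0 S) {i k m n : M} :
    FinMem i (pair (pair k m) n) ↔ i < k ∧ m * (i + 1) + 1 ∣ n := by
  constructor
  · rintro ⟨k', m', n', d, h, hi, hd⟩
    obtain ⟨h', rfl⟩ := hS.pair_inj.1 h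
    obtain ⟨rfl, rfl⟩ := hS.pair_inj.1 h'
    exact ⟨hi, d, hd⟩
  · rintro ⟨hi, d, hd⟩
    exact ⟨k, m, n, d, rfl, hi, hd⟩

theorem lt_of_finMem {i c : M} (h : FinMem i c) : i < c := by
  obtain ⟨k, m, n, d, rfl, hi, -⟩ := h
  exact hi.trans_le ((left_le_pair _ _).trans (left_le_pair _ _))

theorem not_finMem_zero {i : M} : ¬ FinMem i 0 := fun h => _root_.not_lt_zero (lt_of_finMem h)

theorem le_of_eq_succ_mul {a b d : M} (h : b = (a + 1) * d) : d ≤ b := by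
  rw [h, add_mul, one_mul]
  exact le_add_self

theorem def0_dvd (hS : ModelsRCA0 S) {s t : (Fin n → M) → M} (hs : IsTerm s) (ht : IsTerm t) :
    Def0 S fun v => s v + 1 ∣ t v :=
  (Def0.bex (P := fun d v => t v = (s v + 1) * d) (ht.add .one) (.eq hS.sets_nonempty ht.shift
    ((hs.shift.add .one).mul (.var 0)))).congr fun _ =>
      ⟨fun ⟨d, _, h⟩ => ⟨d, h⟩, fun ⟨d, h⟩ => ⟨d, hS.lt_add_one_iff.2 (le_of_eq_succ_mul h), h⟩⟩

theorem def0_finMem (hS : ModelsRCA0 S) {s t : (Fin n → M) → M} (hs : IsTerm s) (ht : IsTerm t) :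
    Def0 S fun v => FinMem (s v) (t v) := by
  refine (Def0.bex (ht.add .one) (.bex (ht.shift.add .one) (.bex (ht.shift.shift.add .one)
    (.and (.eq hS.sets_nonempty ht.shift.shift.shift (((IsTerm.var 2).pair (.var 1)).pair (.var 0)))
      (.and (.lt hS.sets_nonempty hs.shift.shift.shift (.var 2))
        (hS.def0_dvd ((IsTerm.var 1).mul (hs.shift.shift.shift.add .one)) (.var 0))))))).congr
      (P := fun v => ∃ k, k < t v + 1 ∧ ∃ m, m < t v + 1 ∧ ∃ n, n < t v + 1 ∧
        t v = pair (pair k m) n ∧ s v < k ∧ m * (s v + 1) + 1 ∣ n) fun v => ?_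
  constructor
  · rintro ⟨k, _, m, _, n, _, h⟩
    rw [h.1, hS.finMem_pair_iff]
    exact h.2
  · rintro ⟨k, m, n, d, h, hi, hd⟩
    rw [h]
    have h1 := left_le_pair (pair k m) n
    exact ⟨k, hS.lt_add_one_iff.2 ((left_le_pair _ _).trans h1), m,
      hS.lt_add_one_iff.2 ((hS.right_le_pair _ _).trans h1), n,
      hS.lt_add_one_iff.2 (hS.right_le_pair _ _), rfl, hi, d, hd⟩

theorem exists_common_multiple (hS : ModelsRCA0 S) (k : M) :
    ∃ m : M, m ≠ 0 ∧ ∀ t, t < k → t + 1 ∣ m := by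
  refine hS.sig_induction ![] (Q := fun k _ => ∃ m : M, m ≠ 0 ∧ ∀ t, t < k → t + 1 ∣ m)
    (Sig.ex hS (Def0.sig (.and (.ne hS.sets_nonempty (.var 0) .zero)
      (.ball (.var 1) (hS.def0_dvd (.var 0) (.var 1))))))
    ⟨1, one_ne_zero, fun t ht => absurd ht (hS.not_lt_zero t)⟩ ?_ k
  rintro k ⟨m, hm, h⟩
  refine ⟨m * (k + 1), mul_ne_zero hm (hS.succ_ne_zero k), fun t ht => ?_⟩
  rcases (hS.lt_succ _ _).1 ht with ht | rfl
  · exact (h t ht).mul_right _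
  · exact dvd_mul_left _ _

theorem dvd_of_dvd_add {a b c : M} (h : a ∣ b + c) (hb : a ∣ b) : a ∣ c := by
  obtain ⟨x, hx⟩ := h
  obtain ⟨y, rfl⟩ := hb
  rcases le_total y x with hyx | hxy
  · obtain ⟨d, rfl⟩ := exists_add_of_le hyx
    rw [mul_add] at hx
    exact ⟨d, _root_.add_left_cancel hx⟩
  · have h1 : a * y + c ≤ a * y + 0 := by
      rw [hx, _root_.add_zero]
      exact mul_le_mul_right hxy a
    have h2 : c = 0 := le_antisymm (le_of_add_le_add_left h1) zero_le
    exact h2 ▸ dvd_zero a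

/-- A number of the form `m e + 1` is coprime to every divisor of `m`. -/
theorem dvd_of_dvd_mul {a m e s n : M} (ha : a = m * e + 1) (hs : s ∣ m) (h : a ∣ n * s) :
    a ∣ n := by
  obtain ⟨r, rfl⟩ := hs
  refine dvd_of_dvd_add (b := n * s * (r * e)) ?_ (h.mul_right _)
  rw [show n * s * (r * e) + n = n * (s * r * e + 1) by ring, ← ha]
  exact dvd_mul_left _ _

/-- The moduli `m (i + 1) + 1`, `i < k`, are pairwise coprime if `m` is a common multiple of
`1, …, k`: the difference of two of them is `m` times a divisor of `m`. -/
theorem dvd_of_dvd_mul_modulus (hS : ModelsRCA0 S) {k m i j n : M} (hm : ∀ t, t < k → t + 1 ∣ m)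
    (hi : i < k) (hj : j < k) (hij : i ≠ j) (h : m * (i + 1) + 1 ∣ n * (m * (j + 1) + 1)) :
    m * (i + 1) + 1 ∣ n := by
  have key : ∀ t, t < k → m * (i + 1) + 1 ∣ n * m * (t + 1) → m * (i + 1) + 1 ∣ n :=
    fun t ht h => dvd_of_dvd_mul rfl dvd_rfl (dvd_of_dvd_mul rfl (hm t ht) h)
  rcases hij.lt_or_gt with hij | hij
  · obtain ⟨t, rfl⟩ := exists_add_of_le (hS.add_one_le_iff.2 hij)
    refine key t (le_add_self.trans_lt hj) (dvd_of_dvd_add ?_ (dvd_mul_left _ n))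
    convert h using 1
    ring
  · obtain ⟨t, rfl⟩ := exists_add_of_le (hS.add_one_le_iff.2 hij)
    refine key t (le_add_self.trans_lt hi) (dvd_of_dvd_add ?_ h)
    convert dvd_mul_left _ n using 1
    ring

/-- Every bounded set of the model is a coded finite set. The code is the product of the moduli
`m (i + 1) + 1` over the members `i`. -/
theorem exists_code (hS : ModelsRCA0 S) {A : Set M} (hA : A ∈ S) (k : M) :
    ∃ c, ∀ i, FinMem i c ↔ i < k ∧ i ∈ A := by
  obtain ⟨m, hm0, hm⟩ := hS.exists_common_multiple k
  have key : ∀ j : M, ∃ n, ∀ i, i < k → (m * (i + 1) + 1 ∣ n ↔ i < j ∧ i ∈ A) := by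
    refine hS.sig_induction ![k, m]
      (Q := fun j v => ∃ n, ∀ i, i < v 0 → (v 1 * (i + 1) + 1 ∣ n ↔ i < j ∧ i ∈ A))
      (Sig.ex hS (Def0.sig (.ball (.var 2) (.iff
        (hS.def0_dvd ((IsTerm.var 4).mul ((IsTerm.var 0).add .one)) (.var 1))
        (.and (.lt hS.sets_nonempty (.var 0) (.var 2)) (.mem hA (.var 0))))))) ?_ ?_
    · -- A modulus divides `1` only if `m = 0`.
      refine ⟨1, fun i _ => ⟨fun ⟨d, hd⟩ => ?_, fun h => absurd h.1 (hS.not_lt_zero i)⟩⟩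
      have h1 : m * (i + 1) + 1 ≤ 0 + 1 := by
        change 1 = (m * (i + 1) + 1) * d at hd
        rw [zero_add]
        conv_rhs => rw [hd]
        refine hS.le_mul_right ?_
        rintro rfl
        rw [MulZeroClass.mul_zero] at hd
        exact one_ne_zero hd
      exact absurd (le_antisymm (le_of_add_le_add_right h1) zero_le)
        (mul_ne_zero hm0 (hS.succ_ne_zero i))
    · rintro j ⟨n, hn⟩
      change ∀ i, i < k → (m * (i + 1) + 1 ∣ n ↔ i < j ∧ i ∈ A) at hn
      change ∃ n, ∀ i, i < k → (m * (i + 1) + 1 ∣ n ↔ i < j + 1 ∧ i ∈ A)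
      -- An index `j ≥ k` imposes no condition, and its modulus need not be coprime to the others.
      by_cases hj : j < k ∧ j ∈ A
      · refine ⟨n * (m * (j + 1) + 1), fun i hi => ?_⟩
        rcases eq_or_ne i j with rfl | hij
        · exact iff_of_true (dvd_mul_left _ _) ⟨hS.lt_add_one_iff.2 le_rfl, hj.2⟩
        · rw [hS.lt_succ, or_iff_left hij, ← hn i hi]
          exact ⟨hS.dvd_of_dvd_mul_modulus hm hi hj.1 hij, fun h => h.mul_right _⟩
      · refine ⟨n, fun i hi => ?_⟩
        rw [hn i hi, hS.lt_succ]
        refine ⟨fun h => ⟨.inl h.1, h.2⟩, ?_⟩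
        rintro ⟨h | rfl, h'⟩
        exacts [⟨h, h'⟩, absurd ⟨hi, h'⟩ hj]
  obtain ⟨n, hn⟩ := key k
  refine ⟨pair (pair k m) n, fun i => ?_⟩
  rw [hS.finMem_pair_iff]
  exact ⟨fun h => (hn i h.1).1 h.2, fun h => ⟨h.1, (hn i h.1).2 h⟩⟩

theorem exists_finUnion (hS : ModelsRCA0 S) (p q : M) : ∃ r, IsFinUnion r p q := by
  obtain ⟨r, hr⟩ := hS.exists_code (hS.comprehension_def0
    (P := fun i v => FinMem i (v 0) ∨ FinMem i (v 1))
    (.or (hS.def0_finMem (.var 0) (.var 1)) (hS.def0_finMem (.var 0) (.var 2))) ![p, q]) (p + q)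
  refine ⟨r, fun i => (hr i).trans ⟨And.right, fun h => ⟨?_, h⟩⟩⟩
  rcases h with h | h
  exacts [(lt_of_finMem h).trans_le le_self_add, (lt_of_finMem h).trans_le le_add_self]

theorem exists_finInter_lt (hS : ModelsRCA0 S) (p k : M) :
    ∃ r, ∀ i, FinMem i r ↔ FinMem i p ∧ i < k := by
  obtain ⟨r, hr⟩ := hS.exists_code (hS.comprehension_def0 (P := fun i v => FinMem i (v 0))
    (hS.def0_finMem (.var 0) (.var 1)) ![p]) k
  exact ⟨r, fun i => (hr i).trans and_comm⟩

theorem def0_isFinUnion (hS : ModelsRCA0 S) {r p q : (Fin n → M) → M} (hr : IsTerm r)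
    (hp : IsTerm p) (hq : IsTerm q) : Def0 S fun v => IsFinUnion (r v) (p v) (q v) := by
  refine (Def0.ball (P := fun i v => FinMem i (r v) ↔ FinMem i (p v) ∨ FinMem i (q v))
    ((hr.add hp).add hq) (.iff (hS.def0_finMem (.var 0) hr.shift)
      (.or (hS.def0_finMem (.var 0) hp.shift) (hS.def0_finMem (.var 0) hq.shift)))).congr
    fun v => ⟨fun h i => ?_, fun h i _ => h i⟩
  by_cases hi : i < r v + p v + q v
  · exact h i hi
  · rw [not_lt] at hi
    have hn : ∀ {c}, c ≤ r v + p v + q v → ¬ FinMem i c := fun hc h =>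
      absurd (lt_of_finMem h) (not_lt.2 (hc.trans hi))
    exact iff_of_false (hn (le_self_add.trans le_self_add))
      (not_or_intro (hn (le_add_self.trans le_self_add)) (hn le_add_self))

end ModelsRCA0

theorem FinSub.refl (p : M) : FinSub p p := fun _ h => h

theorem FinSub.trans {p q r : M} (h : FinSub p q) (h' : FinSub q r) : FinSub p r :=
  fun i hi => h' i (h i hi)

theorem ModelsRCA0.finSub_of_le (hS : ModelsRCA0 S) {p : M → M} (hp : IsSeq S p)
    (hs : ∀ i, FinSub (p i) (p (i + 1))) {i j : M} (hij : i ≤ j) : FinSub (p i) (p j) := by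
  obtain ⟨d, rfl⟩ := exists_add_of_le hij
  intro k hk
  obtain ⟨y, rfl, hy⟩ : ∃ y, y = p (i + d) ∧ FinMem k y := by
    refine hS.sig_induction ![i, k] (Q := fun d v => ∃ y, y = p (v 0 + d) ∧ FinMem (v 1) y)
      (Sig.ex hS (Def0.sig (.and (.seq hS hp ((IsTerm.var 2).add (.var 1)) (.var 0))
        (hS.def0_finMem (.var 3) (.var 0))))) ⟨_, rfl, by simpa using hk⟩ ?_ d
    rintro d ⟨y, rfl, hy⟩
    refine ⟨_, rfl, ?_⟩
    rw [← add_assoc]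
    exact hs _ _ hy
  exact hy

/-! ### Expressions, filters and open sets -/

theorem exprLe_basic_iff {p : M} {a : M → M} :
    ExprLe (basic p) a ↔ ∃ q, Joinand a q ∧ FinSub q p := by
  refine ⟨fun h => h p ⟨0, rfl⟩, fun h q ⟨_, hq⟩ => ?_⟩
  rwa [← add_right_cancel (hq : p + 1 = q + 1)]

theorem joinand_basic {p q : M} : Joinand (basic p) q ↔ q = p :=
  ⟨fun ⟨_, h⟩ => (add_right_cancel (h : p + 1 = q + 1)).symm, fun h => ⟨0, by rw [h]; rfl⟩⟩

theorem ExprLe.trans {a b c : M → M} (h : ExprLe a b) (h' : ExprLe b c) : ExprLe a c := by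
  intro p hp
  obtain ⟨q, hq, hqp⟩ := h p hp
  obtain ⟨r, hr, hrq⟩ := h' q hq
  exact ⟨r, hr, hrq.trans hqp⟩

theorem satExpr_iff {p a : M → M} : SatExpr p a ↔ ∃ q, Joinand a q ∧ MemBasic p q := by
  simp only [SatExpr, exprLe_basic_iff, MemBasic]
  constructor
  · rintro ⟨k, q, hq, h⟩
    exact ⟨q, hq, k, h⟩
  · rintro ⟨q, hq, k, h⟩
    exact ⟨k, q, hq, h⟩

theorem ModelsRCA0.memOpen_openOf_iff (hS : ModelsRCA0 S) {x a : M → M} :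
    MemOpen x (openOf a) ↔ SatExpr x a := by
  rw [satExpr_iff]
  constructor
  · rintro ⟨n, w, ⟨k, p, h, hk⟩, hw⟩
    obtain ⟨rfl, rfl⟩ := hS.pair_inj.1 h
    exact ⟨w, ⟨n, hk⟩, hw⟩
  · rintro ⟨q, ⟨k, hk⟩, hq⟩
    exact ⟨k, q, ⟨k, q, rfl, hk⟩, hq⟩

theorem SatExpr.mono {p a b : M → M} (h : SatExpr p a) (hab : ExprLe a b) : SatExpr p b :=
  h.imp fun _ hk => hk.trans hab

theorem SamePoint.symm {p q : M → M} (h : SamePoint p q) : SamePoint q p := ⟨h.2, h.1⟩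

theorem SamePoint.satExpr {p q a : M → M} (h : SamePoint p q) (hp : SatExpr p a) :
    SatExpr q a := by
  rw [satExpr_iff] at *
  obtain ⟨w, hw, k, hk⟩ := hp
  obtain ⟨j, hj⟩ := h.1 k
  exact ⟨w, hw, j, hk.trans hj⟩

theorem SamePoint.satExpr_iff {p q a : M → M} (h : SamePoint p q) : SatExpr p a ↔ SatExpr q a :=
  ⟨h.satExpr, h.symm.satExpr⟩

/-! ### Points -/

/-- A point is a decreasing sequence of finite meets that satisfies the relations of the frame:
the remaining conditions on a congruence preorder hold for every such sequence. -/
theorem FrameCode.isPoint_iff {F : FrameCode S} {p : M → M} :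
    F.IsPoint p ↔ IsSeq S p ∧ (∀ i, FinSub (p i) (p (i + 1))) ∧
      ∀ j, SatExpr p (F.lhs j) → SatExpr p (F.rhs j) :=
  ⟨fun h => ⟨h.1, h.2.1, h.2.2.2.1⟩, fun h => ⟨h.1, h.2.1, fun _ _ _ _ hab h => h.mono hab, h.2.2,
    fun _ _ _ _ _ _ hab hbc ha => hbc (hab ha)⟩⟩

theorem FrameCode.mem_toPi2_iff {F : FrameCode S} {x : M → M} :
    F.toPi2.Mem x ↔ IsSpacePoint S x ∧ ∀ j, SatExpr x (F.lhs j) → SatExpr x (F.rhs j) := by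
  have h : ∀ a : M → M, (∃ n w, a n = w + 1 ∧ MemBasic x w) ↔ SatExpr x a := fun a => by
    rw [satExpr_iff]
    constructor
    · rintro ⟨n, w, h, hw⟩
      exact ⟨w, ⟨n, h⟩, hw⟩
    · rintro ⟨w, ⟨n, h⟩, hw⟩
      exact ⟨n, w, h, hw⟩
  simp only [Pi2Code.Mem, toPi2, h, imp_iff_not_or]

namespace ModelsRCA0

/-- An increasing sequence of finite sets is equal as a filter to a point of `P(ℕ)`: the `i`-th
entry is cut down to `{0, …, i}`. -/
theorem exists_isSpacePoint (hS : ModelsRCA0 S) {p : M → M} (hp : IsSeq S p)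
    (hs : ∀ i, FinSub (p i) (p (i + 1))) : ∃ x, IsSpacePoint S x ∧ SamePoint p x := by
  obtain ⟨x, hx, h⟩ := hS.exists_seq (n := 0)
    (R := fun i y _ => ∃ w, w = p i ∧
      ∀ k, k < y + w → (FinMem k y ↔ FinMem k w ∧ k < i + 1))
    (Sig.ex hS (Def0.sig (.and (.seq hS hp (.var 1) (.var 0))
      (.ball ((IsTerm.var 2).add (.var 0)) (.iff (hS.def0_finMem (.var 0) (.var 3))
        (.and (hS.def0_finMem (.var 0) (.var 1))
          (.lt hS.sets_nonempty (.var 0) ((IsTerm.var 2).add .one)))))))) ![] fun i => by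
      obtain ⟨r, hr⟩ := hS.exists_finInter_lt (p i) (i + 1)
      exact ⟨r, p i, rfl, fun k _ => hr k⟩
  have hx' : ∀ i k, FinMem k (x i) ↔ FinMem k (p i) ∧ k < i + 1 := by
    intro i k
    obtain ⟨_, rfl, hi⟩ := h i
    refine ⟨fun h => (hi k ((lt_of_finMem h).trans_le le_self_add)).1 h, fun h =>
      (hi k ((lt_of_finMem h.1).trans_le le_add_self)).2 h⟩
  refine ⟨x, ⟨hx, fun i k hk => ((hx' i k).1 hk).2, fun i j hij k hk => ?_⟩, fun i => ?_,
    fun i => ⟨i, fun k hk => ((hx' i k).1 hk).1⟩⟩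
  · rw [hx'] at *
    exact ⟨hS.finSub_of_le hp hs hij.le k hk.1, hk.2.trans (add_lt_add_left hij 1)⟩
  · -- The members of the finite set coded by `p i` are less than the code.
    refine ⟨i + p i, fun k hk => (hx' _ _).2 ⟨hS.finSub_of_le hp hs le_self_add k hk, ?_⟩⟩
    exact ((lt_of_finMem hk).trans_le le_add_self).trans (hS.lt_add_one_iff.2 le_rfl)

theorem isPoint_of_mem (hS : ModelsRCA0 S) {F : FrameCode S} {x : M → M} (hx : F.toPi2.Mem x) :
    F.IsPoint x := by
  rw [FrameCode.mem_toPi2_iff] at hx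
  exact FrameCode.isPoint_iff.2 ⟨hx.1.1, fun i => hx.1.2.2 i _ (hS.lt_add_one_iff.2 le_rfl), hx.2⟩

theorem exists_mem_of_isPoint (hS : ModelsRCA0 S) {F : FrameCode S} {p : M → M}
    (hp : F.IsPoint p) : ∃ x, F.toPi2.Mem x ∧ SamePoint p x := by
  rw [FrameCode.isPoint_iff] at hp
  obtain ⟨x, hx, h⟩ := hS.exists_isSpacePoint hp.1 hp.2.1
  refine ⟨x, FrameCode.mem_toPi2_iff.2 ⟨hx, fun j hj => ?_⟩, h⟩
  exact h.satExpr (hp.2.2 j (h.symm.satExpr hj))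

theorem isPointSpace (hS : ModelsRCA0 S) (F : FrameCode S) : IsPointSpace F F.toPi2 where
  isPoint _ := hS.isPoint_of_mem
  exists_mem _ := hS.exists_mem_of_isPoint
  sat_iff _ _ _ _ _ h _ := by rw [hS.memOpen_openOf_iff, h.satExpr_iff]

theorem ptLe_iff (hS : ModelsRCA0 S) {F : FrameCode S} {a b : M → M} :
    F.PtLe a b ↔ ∀ x, F.toPi2.Mem x → SatExpr x a → SatExpr x b := by
  refine ⟨fun h x hx => h x (hS.isPoint_of_mem hx), fun h p hp ha => ?_⟩
  obtain ⟨x, hx, hpx⟩ := hS.exists_mem_of_isPoint hp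
  exact hpx.symm.satExpr (h x hx (hpx.satExpr ha))

/-! ### The least congruence preorder -/

/-- The smallest choice of `(Q, ≺_Q)`: the index `(0, p)` stands for the finite set `p`, and the
indices `(1, j)` and `(2, j)` for the two sides of the `j`-th relation; the only instances of `≺_Q`
are reflexivity and the relations of the frame. -/
theorem exists_congruenceCode (hS : ModelsRCA0 S) (F : FrameCode S) :
    ∃ Q : CongruenceCode F, ∀ c d, pair c d ∈ Q.rel →
      c = d ∨ ∃ j, Q.expr c = F.lhs j ∧ Q.expr d = F.rhs j := by
  have ne1 : (1 : M) ≠ 0 := one_ne_zero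
  have ne2 : (1 + 1 : M) ≠ 0 := hS.succ_ne_zero 1
  have ne3 : (1 + 1 : M) ≠ 1 := by simp
  obtain ⟨e, he, hR⟩ := hS.exists_doubleSeq
    (R := fun c k y => NotPair c ∨ ∃ t j, c = pair t j ∧ (t = 0 → y = j + 1) ∧
      (t = 1 → y = F.lhs j k) ∧ (t = 1 + 1 → y = F.rhs j k))
    (.or (Def0.sig (.notPair hS (.var 0))) (Sig.ex hS (Sig.ex hS (Def0.sig
      (.and (.eq hS.sets_nonempty (.var 2) ((IsTerm.var 1).pair (.var 0)))
      (.and (.imp (.eq hS.sets_nonempty (.var 1) .zero)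
        (.eq hS.sets_nonempty (.var 4) ((IsTerm.var 0).add .one)))
      (.and (.imp (.eq hS.sets_nonempty (.var 1) .one)
        (.doubleSeq hS F.lhs_mem (.var 0) (.var 3) (.var 4)))
      (.imp (.eq hS.sets_nonempty (.var 1) (IsTerm.one.add .one))
        (.doubleSeq hS F.rhs_mem (.var 0) (.var 3) (.var 4)))))))))) fun c k => by
      rcases notPair_or_exists c with hc | ⟨t, j, rfl⟩
      · exact ⟨0, .inl hc⟩
      · by_cases h0 : t = 0
        · exact ⟨j + 1, .inr ⟨t, j, rfl, fun _ => rfl, fun h => absurd (h.symm.trans h0) ne1,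
            fun h => absurd (h.symm.trans h0) ne2⟩⟩
        by_cases h1 : t = 1
        · exact ⟨F.lhs j k, .inr ⟨t, j, rfl, fun h => absurd h h0, fun _ => rfl,
            fun h => absurd (h.symm.trans h1) ne3⟩⟩
        · exact ⟨F.rhs j k, .inr ⟨t, j, rfl, fun h => absurd h h0, fun h => absurd h h1,
            fun _ => rfl⟩⟩
  have he' : ∀ t j k, (t = 0 → e (pair t j) k = j + 1) ∧ (t = 1 → e (pair t j) k = F.lhs j k) ∧
      (t = 1 + 1 → e (pair t j) k = F.rhs j k) := by
    intro t j k
    rcases hR (pair t j) k with h | ⟨t', j', h, h'⟩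
    · exact absurd h (hS.not_notPair t j)
    · obtain ⟨rfl, rfl⟩ := hS.pair_inj.1 h
      exact h'
  have e1 : ∀ j, e (pair 1 j) = F.lhs j := fun j => funext fun k => (he' 1 j k).2.1 rfl
  have e2 : ∀ j, e (pair (1 + 1) j) = F.rhs j := fun j => funext fun k => (he' _ j k).2.2 rfl
  have hrel := hS.comprehension_def0 (n := 0)
    (P := fun z _ => ∃ c, c < z + 1 ∧ (z = pair c c ∨ z = pair (pair 1 c) (pair (1 + 1) c)))
    (.bex ((IsTerm.var 0).add .one) (.or
      (.eq hS.sets_nonempty (.var 1) ((IsTerm.var 0).pair (.var 0)))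
      (.eq hS.sets_nonempty (.var 1) ((IsTerm.one.pair (.var 0)).pair
        ((IsTerm.one.add .one).pair (.var 0)))))) ![]
  refine ⟨⟨e, he, _, hrel, fun p => ⟨pair 0 p, funext fun k => (he' 0 p k).1 rfl⟩,
    fun j => ⟨pair 1 j, pair (1 + 1) j, e1 j, e2 j, j, ?_, .inr rfl⟩,
    fun i => ⟨i, hS.lt_add_one_iff.2 (left_le_pair _ _), .inl rfl⟩⟩, ?_⟩
  · exact hS.lt_add_one_iff.2 ((hS.right_le_pair _ _).trans (left_le_pair _ _))
  · rintro c d ⟨j, -, h | h⟩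
    · obtain ⟨rfl, rfl⟩ := hS.pair_inj.1 h
      exact .inl rfl
    · obtain ⟨rfl, rfl⟩ := hS.pair_inj.1 h
      exact .inr ⟨j, e1 j, e2 j⟩

theorem exists_tail (hS : ModelsRCA0 S) {x : M → M} (hx : IsSeq S x) (k : M) :
    IsSeq S fun i => x (k + i) := by
  obtain ⟨f, hf, h⟩ := hS.exists_seq (n := 1) (R := fun i y v => y = x (v 0 + i))
    (Def0.sig (.seq hS hx ((IsTerm.var 2).add (.var 0)) (.var 1))) ![k] fun i => ⟨_, rfl⟩
  rwa [show f = fun i => x (k + i) from funext h] at hf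

/-- Soundness: for a point `x` of the space, a tail of `x` is one of the sequences that define the
preorder generated by the smallest `(Q, ≺_Q)`. Completeness: a sequence that satisfies `φ` is a
point, and if it meets `b` then it meets a finite set below `b`, which is an element of `Q`. -/
theorem prec_iff (hS : ModelsRCA0 S) {F : FrameCode S} {a b : M → M} :
    F.Prec a b ↔ ∀ x, F.toPi2.Mem x → SatExpr x a → SatExpr x b := by
  constructor
  · intro h x hx ⟨k, hk⟩
    obtain ⟨Q, hQ⟩ := hS.exists_congruenceCode F
    rw [FrameCode.mem_toPi2_iff] at hx
    have mono : ∀ {i j}, i ≤ j → FinSub (x i) (x j) := fun {i j} hij => by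
      rcases hij.eq_or_lt with rfl | hij
      exacts [.refl _, hx.1.2.2 _ _ hij]
    -- An expression that is met by `x` is met by the tail from `k` on.
    have sat : ∀ {c}, SatExpr x c → ∃ l, ExprLe (basic (x (k + l))) c := fun {c} ⟨l, hl⟩ => by
      rw [exprLe_basic_iff] at hl
      obtain ⟨q, hq, hql⟩ := hl
      exact ⟨l, exprLe_basic_iff.2 ⟨q, hq, hql.trans (mono le_add_self)⟩⟩
    have hphi : Q.Phi fun i => x (k + i) := by
      refine ⟨fun i => mono (add_le_add_right (hS.lt_add_one_iff.2 le_rfl).le k), ?_⟩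
      intro c d i hcd hi
      rcases hQ c d hcd with rfl | ⟨j, hc, hd⟩
      · exact ⟨i, hi⟩
      · rw [hc] at hi
        rw [hd]
        exact sat (hx.2 j ⟨_, hi⟩)
    obtain ⟨i, r, l, hr, hrl, hl⟩ := h Q _ (hS.exists_tail hx.1.1 k) hphi
      (by simpa only [_root_.add_zero] using hk)
    obtain ⟨m, hm⟩ := hphi.2 r l i hrl hr
    exact ⟨k + m, hm.trans hl⟩
  · rw [← hS.ptLe_iff]
    intro h Q p hp hphi h0
    have hpt : F.IsPoint p := by
      refine FrameCode.isPoint_iff.2 ⟨hp, hphi.1, fun j ⟨k, hk⟩ => ?_⟩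
      obtain ⟨c, d, hc, hd, hcd⟩ := Q.relation_mem j
      rw [← hc] at hk
      rw [← hd]
      exact hphi.2 c d k hcd hk
    obtain ⟨k, hk⟩ := h p hpt ⟨0, h0⟩
    obtain ⟨q, hq, hqk⟩ := exprLe_basic_iff.1 hk
    obtain ⟨i, hi⟩ := Q.finite_mem q
    refine ⟨k, i, i, ?_, Q.refl_mem i, ?_⟩
    · rw [hi]
      exact exprLe_basic_iff.2 ⟨q, joinand_basic.2 rfl, hqk⟩
    · rw [hi]
      exact exprLe_basic_iff.2 ⟨q, hq, .refl q⟩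

/-! ### Spatiality -/

theorem openOf_mem (hS : ModelsRCA0 S) {a : M → M} (ha : IsSeq S a) : openOf a ∈ S := by
  have := hS.comprehension_def0 (n := 0)
    (P := fun z _ => ∃ k, k < z + 1 ∧ ∃ p, p < z + 1 ∧ z = pair k p ∧ p + 1 = a k)
    (.bex ((IsTerm.var 0).add .one) (.bex ((IsTerm.var 1).add .one) (.and
      (.eq hS.sets_nonempty (.var 2) ((IsTerm.var 1).pair (.var 0)))
      (.seq hS ha (.var 1) ((IsTerm.var 0).add .one))))) ![]
  refine (congrArg (· ∈ S) (Set.ext fun z => ?_)).mpr this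
  constructor
  · rintro ⟨k, p, rfl, h⟩
    exact ⟨k, hS.lt_add_one_iff.2 (left_le_pair _ _), p, hS.lt_add_one_iff.2 (hS.right_le_pair _ _),
      rfl, h.symm⟩
  · rintro ⟨k, _, p, _, h, h'⟩
    exact ⟨k, p, h, h'.symm⟩

theorem exists_expr_of_open (hS : ModelsRCA0 S) {U : Set M} (hU : U ∈ S) :
    ∃ a, IsSeq S a ∧ ∀ x, MemOpen x (openOf a) ↔ MemOpen x U := by
  obtain ⟨a, ha, h⟩ := hS.exists_seq (n := 0)
    (R := fun c y _ => ((c ∉ U ∨ NotPair c) ∧ y = 0) ∨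
      ∃ k w, c = pair k w ∧ c ∈ U ∧ y = w + 1)
    (.or (Def0.sig (.and (.or (.not (.mem hU (.var 0))) (.notPair hS (.var 0)))
        (.eq hS.sets_nonempty (.var 1) .zero)))
      (Sig.ex hS (Sig.ex hS (Def0.sig (.and
        (.eq hS.sets_nonempty (.var 2) ((IsTerm.var 1).pair (.var 0)))
        (.and (.mem hU (.var 2)) (.eq hS.sets_nonempty (.var 3) ((IsTerm.var 0).add .one)))))))) ![]
    fun c => by
      by_cases hc : c ∈ U
      · rcases notPair_or_exists c with h | ⟨k, w, rfl⟩
        · exact ⟨0, .inl ⟨.inr h, rfl⟩⟩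
        · exact ⟨w + 1, .inr ⟨k, w, rfl, hc, rfl⟩⟩
      · exact ⟨0, .inl ⟨.inl hc, rfl⟩⟩
  refine ⟨a, ha, fun x => ?_⟩
  rw [hS.memOpen_openOf_iff, satExpr_iff]
  constructor
  · rintro ⟨q, ⟨c, hc⟩, hq⟩
    rcases h c with ⟨-, h0⟩ | ⟨k, w, rfl, hU, hw⟩
    · exact absurd (hc.symm.trans h0) (hS.succ_ne_zero q)
    · obtain rfl : q = w := add_right_cancel (hc.symm.trans hw)
      exact ⟨k, q, hU, hq⟩
  · rintro ⟨k, w, hkw, hw⟩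
    refine ⟨w, ⟨pair k w, ?_⟩, hw⟩
    rcases h (pair k w) with ⟨h | h, -⟩ | ⟨k', w', h, -, h'⟩
    · exact absurd hkw h
    · exact absurd h (hS.not_notPair k w)
    · rw [h', (hS.pair_inj.1 h).2]

/-- The joinand with index `(i, j)` is the `j`-th joinand of `w i`. -/
theorem exists_isJoinExpr (hS : ModelsRCA0 S) {w : M → M → M} (hw : IsDoubleSeq S w) :
    ∃ c, IsSeq S c ∧ IsJoinExpr c w := by
  obtain ⟨c, hc, h⟩ := hS.exists_seq (n := 0)
    (R := fun c y _ => (NotPair c ∧ y = 0) ∨ ∃ i j, c = pair i j ∧ y = w i j)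
    (.or (Def0.sig (.and (.notPair hS (.var 0)) (.eq hS.sets_nonempty (.var 1) .zero)))
      (Sig.ex hS (Sig.ex hS (Def0.sig (.and
        (.eq hS.sets_nonempty (.var 2) ((IsTerm.var 1).pair (.var 0)))
        (.doubleSeq hS hw (.var 1) (.var 0) (.var 3))))))) ![] fun c => by
      rcases notPair_or_exists c with h | ⟨i, j, rfl⟩
      exacts [⟨0, .inl ⟨h, rfl⟩⟩, ⟨_, .inr ⟨i, j, rfl, rfl⟩⟩]
  refine ⟨c, hc, fun p => ⟨?_, ?_⟩⟩
  · rintro ⟨k, hk⟩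
    rcases h k with ⟨-, h0⟩ | ⟨i, j, rfl, h'⟩
    · exact absurd (hk.symm.trans h0) (hS.succ_ne_zero p)
    · exact ⟨i, j, h'.symm.trans hk⟩
  · rintro ⟨i, j, hj⟩
    refine ⟨pair i j, ?_⟩
    rcases h (pair i j) with ⟨h, -⟩ | ⟨i', j', h, h'⟩
    · exact absurd h (hS.not_notPair i j)
    · obtain ⟨rfl, rfl⟩ := hS.pair_inj.1 h
      exact h'.trans hj

/-- The joinand with index `(i, j)` is the union of the `i`-th joinand of `a` and the `j`-th joinand
of `b`, or the formal bottom if one of these is. -/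
theorem exists_isMeetExpr (hS : ModelsRCA0 S) {a b : M → M} (ha : IsSeq S a) (hb : IsSeq S b) :
    ∃ c, IsSeq S c ∧ IsMeetExpr c a b := by
  obtain ⟨c, hc, h⟩ := hS.exists_seq (n := 0)
    (R := fun c y _ => (NotPair c ∧ y = 0) ∨ ∃ i j, c = pair i j ∧
      (((0 = a i ∨ 0 = b j) ∧ y = 0) ∨
        ∃ p q r, p + 1 = a i ∧ q + 1 = b j ∧ IsFinUnion r p q ∧ y = r + 1))
    (.or (Def0.sig (.and (.notPair hS (.var 0)) (.eq hS.sets_nonempty (.var 1) .zero)))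
      (Sig.ex hS (Sig.ex hS (.and hS
        (Def0.sig (.eq hS.sets_nonempty (.var 2) ((IsTerm.var 1).pair (.var 0))))
        (.or
          (Def0.sig (.and (.or (.seq hS ha (.var 1) .zero) (.seq hS hb (.var 0) .zero))
            (.eq hS.sets_nonempty (.var 3) .zero)))
          (Sig.ex hS (Sig.ex hS (Sig.ex hS (Def0.sig
            (.and (.seq hS ha (.var 4) ((IsTerm.var 2).add .one))
            (.and (.seq hS hb (.var 3) ((IsTerm.var 1).add .one))
            (.and (hS.def0_isFinUnion (.var 0) (.var 2) (.var 1))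
              (.eq hS.sets_nonempty (.var 6) ((IsTerm.var 0).add .one)))))))))))))) ![] fun c => by
      rcases notPair_or_exists c with h | ⟨i, j, rfl⟩
      · exact ⟨0, .inl ⟨h, rfl⟩⟩
      · rcases hS.eq_zero_or_eq_succ (a i) with h | ⟨p, hp⟩
        · exact ⟨0, .inr ⟨i, j, rfl, .inl ⟨.inl h.symm, rfl⟩⟩⟩
        rcases hS.eq_zero_or_eq_succ (b j) with h | ⟨q, hq⟩
        · exact ⟨0, .inr ⟨i, j, rfl, .inl ⟨.inr h.symm, rfl⟩⟩⟩
        obtain ⟨r, hr⟩ := hS.exists_finUnion p q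
        exact ⟨r + 1, .inr ⟨i, j, rfl, .inr ⟨p, q, r, hp.symm, hq.symm, hr, rfl⟩⟩⟩
  refine ⟨c, hc, ?_, ?_⟩
  · rintro r ⟨k, hk⟩
    rcases h k with ⟨-, h0⟩ | ⟨i, j, rfl, ⟨-, h0⟩ | ⟨p, q, r', hp, hq, hr, hy⟩⟩
    · exact absurd (hk.symm.trans h0) (hS.succ_ne_zero r)
    · exact absurd (hk.symm.trans h0) (hS.succ_ne_zero r)
    · obtain rfl : r = r' := add_right_cancel (hk.symm.trans hy)
      exact ⟨p, q, ⟨i, hp.symm⟩, ⟨j, hq.symm⟩, hr⟩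
  · rintro p q ⟨i, hi⟩ ⟨j, hj⟩
    rcases h (pair i j) with ⟨h, -⟩ | ⟨i', j', h, h'⟩
    · exact absurd h (hS.not_notPair i j)
    · obtain ⟨rfl, rfl⟩ := hS.pair_inj.1 h
      rcases h' with ⟨h0 | h0, -⟩ | ⟨p', q', r, hp, hq, hr, hy⟩
      · exact absurd (h0.trans hi).symm (hS.succ_ne_zero p)
      · exact absurd (h0.trans hj).symm (hS.succ_ne_zero q)
      · obtain rfl : p' = p := add_right_cancel (hp.trans hi)
        obtain rfl : q' = q := add_right_cancel (hq.trans hj)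
        exact ⟨r, ⟨_, hy⟩, hr⟩

theorem isSeq_const (hS : ModelsRCA0 S) {t : (Fin 0 → M) → M} (ht : IsTerm t) :
    IsSeq S fun _ => t ![] := by
  obtain ⟨f, hf, h⟩ := hS.exists_seq (n := 0) (R := fun _ y v => y = t v)
    (Def0.sig (.eq hS.sets_nonempty (.var 1) ht.shift.shift)) ![] fun _ => ⟨_, rfl⟩
  rwa [show f = fun _ => t ![] from funext h] at hf

theorem isSpatial (hS : ModelsRCA0 S) (F : FrameCode S) {T : (M → M) → (M → M) → Prop}
    (hT : ∀ a b, T a b ↔ ∀ x, F.toPi2.Mem x → SatExpr x a → SatExpr x b) :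
    IsSpatial T F.toPi2 where
  open_mem _ := hS.openOf_mem
  reflects a b _ _ := by simp only [hT, hS.memOpen_openOf_iff]
  surjective U hU := by
    obtain ⟨a, ha, h⟩ := hS.exists_expr_of_open hU
    exact ⟨a, ha, fun x _ => h x⟩
  exists_join _ := hS.exists_isJoinExpr
  map_join c w _ _ h x _ := by
    simp only [hS.memOpen_openOf_iff, satExpr_iff, h _]
    constructor
    · rintro ⟨q, ⟨n, hn⟩, hq⟩
      exact ⟨n, q, hn, hq⟩
    · rintro ⟨n, q, hn, hq⟩
      exact ⟨q, ⟨n, hn⟩, hq⟩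
  exists_meet _ _ := hS.exists_isMeetExpr
  map_meet a b c _ _ _ h x hx := by
    simp only [hS.memOpen_openOf_iff, satExpr_iff]
    constructor
    · rintro ⟨r, hr, k, hk⟩
      obtain ⟨p, q, hp, hq, hu⟩ := h.1 r hr
      exact ⟨⟨p, hp, k, fun i hi => hk i ((hu i).2 (.inl hi))⟩,
        q, hq, k, fun i hi => hk i ((hu i).2 (.inr hi))⟩
    · rintro ⟨⟨p, hp, k, hk⟩, q, hq, l, hl⟩
      obtain ⟨r, hr, hu⟩ := h.2 p q hp hq
      have mono : ∀ {i j}, i ≤ j → FinSub (x i) (x j) := fun {i j} hij => by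
        rcases hij.eq_or_lt with rfl | hij
        exacts [.refl _, hx.1.2.2 _ _ hij]
      refine ⟨r, hr, max k l, fun i hi => ?_⟩
      rcases (hu i).1 hi with hi | hi
      exacts [mono (le_max_left k l) i (hk i hi), mono (le_max_right k l) i (hl i hi)]
  map_bot := by
    refine ⟨hS.isSeq_const .zero, fun x _ h => ?_⟩
    rw [hS.memOpen_openOf_iff, satExpr_iff] at h
    obtain ⟨q, ⟨_, h⟩, -⟩ := h
    exact hS.succ_ne_zero q h.symm
  map_top := by
    refine ⟨hS.isSeq_const (IsTerm.zero.add .one), fun x _ => ?_⟩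
    rw [hS.memOpen_openOf_iff, satExpr_iff]
    exact ⟨0, joinand_basic.2 rfl, 0, fun i hi => absurd hi not_finMem_zero⟩

/-- The equivalence of the representations, for a model presented as an ordered semiring. -/
theorem representations_equivalent (hS : ModelsRCA0 S) :
    (∀ F : FrameCode S,
      IsSpatial F.Prec F.toPi2 ∧ IsSpatial F.PtLe F.toPi2 ∧ IsPointSpace F F.toPi2) ∧
    (∀ (F : FrameCode S) (a b : M → M), IsSeq S a → IsSeq S b → (F.Prec a b ↔ F.PtLe a b)) ∧
    (∀ X : Pi2Code S,
      IsSpatial X.toFrame.Prec X ∧ IsSpatial X.toFrame.PtLe X ∧ IsPointSpace X.toFrame X) ∧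
    (∀ F : FrameCode S, F.toPi2.toFrame = F) ∧
    (∀ X : Pi2Code S, X.toFrame.toPi2 = X) := by
  have key : ∀ F : FrameCode S,
      IsSpatial F.Prec F.toPi2 ∧ IsSpatial F.PtLe F.toPi2 ∧ IsPointSpace F F.toPi2 := fun F =>
    ⟨hS.isSpatial F fun _ _ => hS.prec_iff, hS.isSpatial F fun _ _ => hS.ptLe_iff,
      hS.isPointSpace F⟩
  exact ⟨key, fun F a b _ _ => by rw [hS.prec_iff, hS.ptLe_iff], fun X => key X.toFrame,
    fun _ => rfl, fun _ => rfl⟩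

end ModelsRCA0

end OrderedModel

end SecondOrderArith

theorem mainTheorem3 {M : Type*} [Zero M] [One M] [Add M] [Mul M] [LT M]
    (S : Set (Set M)) (hS : ModelsRCA0 S) :
    -- frames give subspaces, for both preorders
    (∀ F : FrameCode S,
      IsSpatial F.Prec F.toPi2 ∧ IsSpatial F.PtLe F.toPi2 ∧ IsPointSpace F F.toPi2) ∧
    -- the two preorders of a frame coincide
    (∀ (F : FrameCode S) (a b : M → M), IsSeq S a → IsSeq S b → (F.Prec a b ↔ F.PtLe a b)) ∧
    -- subspaces give frames, for both preorders
    (∀ X : Pi2Code S,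
      IsSpatial X.toFrame.Prec X ∧ IsSpatial X.toFrame.PtLe X ∧ IsPointSpace X.toFrame X) ∧
    -- the translations are mutually inverse
    (∀ F : FrameCode S, F.toPi2.toFrame = F) ∧
    (∀ X : Pi2Code S, X.toFrame.toPi2 = X) := by
  let := hS.commSemiring
  let := hS.linearOrder
  have := hS.isStrictOrderedRing
  have := hS.canonicallyOrderedAdd
  exact hS.representations_equivalent
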